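/- Conventions. A *prop* is a symmetric strict monoidal category whose objects are the natural numbers and whose tensor product is addition on objects; a *morphism of props* is a symmetric strict monoidal functor that is the identity on objects. A *special bicommutative bimonoid* $(X,\mu,\eta,\delta,\epsilon)$ in a symmetric monoidal category $\mathcal C$ is a commutative monoid $(X,\mu,\eta)$ together with a cocommutative comonoid $(X,\delta,\epsilon)$ satisfying the bimonoid laws $\delta\circ\mu=(\mu\otimes\mu)\circ(1\otimes\sigma\otimes 1)\circ(\delta\otimes\delta)$ (with $\sigma$ the symmetry), $\epsilon\circ\mu=\epsilon\otimes\epsilon$, $\delta\circ\eta=\eta\otimes\eta$, the extra law $\epsilon\circ\eta=\mathrm{id}_I$, and the special law $\mu\circ\delta=\mathrm{id}_X$. The morphisms of these structures are the morphisms of $\mathcal C$ commuting with all four operations. Let $\mathbf{Th}$ be the prop presented by generators $\mu:2\to1$, $\eta:0\to1$, $\delta:1\to2$, $\epsilon:1\to0$ and the above equations, i.e. its morphisms are the terms built from the generators, identities and symmetries by composition and tensor product, modulo the smallest congruence containing the equations and the laws of a prop. Let $\mathbf{Rel}$ be the prop whose morphisms $m\to n$ are the binary relations from $\{0,\dots,m-1\}$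 to $\{0,\dots,n-1\}$, with relational composition, and with tensor product and symmetry given by disjoint union. Theorem. 1. $\mathbf{Rel}$ is equivalent, as a symmetric monoidal category, to the category of finite sets and relations with disjoint union as monoidal product. 2. $\mathbf{Th}$ is the prop for special bicommutative bimonoids: for every symmetric monoidal category $\mathcal C$, the category of algebras of $\mathbf{Th}$ in $\mathcal C$ (symmetric strong monoidal functors $\mathbf{Th}\to\mathcal C$ and monoidal natural transformations) is equivalent to the category of special bicommutative bimonoids in $\mathcal C$, by an equivalence compatible, up to natural isomorphism, with underlying objects ($F\mapsto F(1)$ on algebras); and if $\mathcal C$ is strict, the same holds for the category of strict algebras (symmetric strict monoidal functors). 3. $\mathbf{Rel}$ and $\mathbf{Th}$ are isomorphic as props. -/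

import Mathlib

open CategoryTheory MonoidalCategory

universe v u w

namespace SymMonTheory

/-! ### Props -/

/-- The operations of a prop: hom-sets indexed by pairs of natural numbers, identities,
composition (in diagrammatic order), the tensor product (which on objects is addition) and the
braiding. No laws are imposed yet. -/
structure PropData where
  Hom : ℕ → ℕ → Type w
  id (n : ℕ) : Hom n n
  comp {l m n : ℕ} : Hom l m → Hom m n → Hom l n
  tensor {m n p q : ℕ} : Hom m n → Hom p q → Hom (m + p) (n + q)
  braid (m n : ℕ) : Hom (m + n) (n + m)

/-- An equality of objects, regarded as an (identity) morphism. -/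
def PropData.eqHom (D : PropData.{w}) {m n : ℕ} (h : m = n) : D.Hom m n :=
  h ▸ D.id m

/-- A prop: a symmetric strict monoidal category whose objects are the natural numbers and whose
tensor product is addition on objects. Strictness means that the associator and the unitors
are the identities `eqHom`; the right unit law needs no `eqHom` as `n + 0` is `n` by definition. -/
structure PROP extends PropData.{w} where
  id_comp {m n : ℕ} (f : Hom m n) : comp (id m) f = f
  comp_id {m n : ℕ} (f : Hom m n) : comp f (id n) = f
  assoc {k l m n : ℕ} (f : Hom k l) (g : Hom l m) (h : Hom m n) :
    comp (comp f g) h = comp f (comp g h)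
  tensor_id (m n : ℕ) : tensor (id m) (id n) = id (m + n)
  tensor_comp {l m n p q r : ℕ} (f : Hom l m) (g : Hom m n) (f' : Hom p q) (g' : Hom q r) :
    tensor (comp f g) (comp f' g') = comp (tensor f f') (tensor g g')
  tensor_assoc {a b c a' b' c' : ℕ} (f : Hom a a') (g : Hom b b') (h : Hom c c') :
    comp (tensor (tensor f g) h) (toPropData.eqHom (Nat.add_assoc a' b' c')) =
      comp (toPropData.eqHom (Nat.add_assoc a b c)) (tensor f (tensor g h))
  id_zero_tensor {m n : ℕ} (f : Hom m n) :
    comp (tensor (id 0) f) (toPropData.eqHom (Nat.zero_add n)) =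
      comp (toPropData.eqHom (Nat.zero_add m)) f
  tensor_id_zero {m n : ℕ} (f : Hom m n) : tensor f (id 0) = f
  braid_natural {m n p q : ℕ} (f : Hom m n) (g : Hom p q) :
    comp (tensor f g) (braid n q) = comp (braid m p) (tensor g f)
  braid_symm (m n : ℕ) : comp (braid m n) (braid n m) = id (m + n)
  hexagon (m n p : ℕ) :
    comp (toPropData.eqHom (Nat.add_assoc m n p))
        (comp (braid m (n + p)) (toPropData.eqHom (Nat.add_assoc n p m))) =
      comp (tensor (braid m n) (id p))
        (comp (toPropData.eqHom (Nat.add_assoc n m p)) (tensor (id n) (braid m p)))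

namespace PROP

/-- A morphism of props: a symmetric strict monoidal functor which is the identity on objects. -/
@[ext]
structure Morphism (P Q : PROP.{w}) where
  map : ∀ {m n : ℕ}, P.Hom m n → Q.Hom m n
  map_id : ∀ n : ℕ, map (P.id n) = Q.id n
  map_comp : ∀ {l m n : ℕ} (f : P.Hom l m) (g : P.Hom m n),
    map (P.comp f g) = Q.comp (map f) (map g)
  map_tensor : ∀ {m n p q : ℕ} (f : P.Hom m n) (g : P.Hom p q),
    map (P.tensor f g) = Q.tensor (map f) (map g)
  map_braid : ∀ m n : ℕ, map (P.braid m n) = Q.braid m n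

/-- The category of props. -/
instance : Category PROP.{w} where
  Hom P Q := Morphism P Q
  id P := ⟨fun f => f, fun _ => rfl, fun _ _ => rfl, fun _ _ => rfl, fun _ _ => rfl⟩
  comp F G := ⟨fun f => G.map (F.map f), fun n => by rw [F.map_id, G.map_id],
    fun f g => by rw [F.map_comp, G.map_comp], fun f g => by rw [F.map_tensor, G.map_tensor],
    fun m n => by rw [F.map_braid, G.map_braid]⟩

variable (P : PROP.{w})

theorem eqHom_comp_eqHom {l m n : ℕ} (h : l = m) (h' : m = n) :
    P.comp (P.eqHom h) (P.eqHom h') = P.eqHom (h.trans h') := by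
  subst h; subst h'; exact P.id_comp _

theorem tensor_eqHom {m n p q : ℕ} (h : m = n) (h' : p = q) :
    P.tensor (P.eqHom h) (P.eqHom h') = P.eqHom (by rw [h, h'] : m + p = n + q) := by
  subst h; subst h'; exact P.tensor_id _ _

theorem tensor_id_eqHom (m : ℕ) {p q : ℕ} (h' : p = q) :
    P.tensor (P.id m) (P.eqHom h') = P.eqHom (by rw [h'] : m + p = m + q) :=
  P.tensor_eqHom rfl h'

theorem tensor_eqHom_id {m n : ℕ} (h : m = n) (p : ℕ) :
    P.tensor (P.eqHom h) (P.id p) = P.eqHom (by rw [h] : m + p = n + p) :=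
  P.tensor_eqHom h rfl

/-- The objects of the prop `P`, i.e. the natural numbers. -/
structure Ob (P : PROP.{w}) where
  val : ℕ

/-- The underlying category of a prop. -/
instance : Category.{w} P.Ob where
  Hom m n := P.Hom m.val n.val
  id m := P.id m.val
  comp f g := P.comp f g
  id_comp f := P.id_comp f
  comp_id f := P.comp_id f
  assoc f g h := P.assoc f g h

/-- An equality of objects, regarded as an isomorphism. -/
def eqIso {X Y : P.Ob} (h : X.val = Y.val) : X ≅ Y where
  hom := P.eqHom h
  inv := P.eqHom h.symm
  hom_inv_id := P.eqHom_comp_eqHom _ _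
  inv_hom_id := P.eqHom_comp_eqHom _ _

instance : MonoidalCategoryStruct P.Ob where
  tensorObj m n := ⟨m.val + n.val⟩
  tensorUnit := ⟨0⟩
  tensorHom {m n p q} f g :=
    (P.tensor (m := m.val) (n := n.val) (p := p.val) (q := q.val) f g :
      P.Hom (m.val + p.val) (n.val + q.val))
  whiskerLeft m {p q} g :=
    (P.tensor (P.id m.val) (p := p.val) (q := q.val) g : P.Hom (m.val + p.val) (m.val + q.val))
  whiskerRight {m n} f p :=
    (P.tensor (m := m.val) (n := n.val) f (P.id p.val) : P.Hom (m.val + p.val) (n.val + p.val))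
  associator a b c := P.eqIso (Nat.add_assoc a.val b.val c.val)
  leftUnitor a := P.eqIso (Nat.zero_add a.val)
  rightUnitor a := P.eqIso (Nat.add_zero a.val)

/-- The (strict) monoidal structure of a prop. -/
instance : MonoidalCategory P.Ob :=
  MonoidalCategory.ofTensorHom
    (id_tensorHom_id := fun m n => P.tensor_id m.val n.val)
    (id_tensorHom := fun _ _ _ _ => rfl)
    (tensorHom_id := fun _ _ => rfl)
    (tensorHom_comp_tensorHom := fun f₁ f₂ g₁ g₂ => (P.tensor_comp f₁ g₁ f₂ g₂).symm)
    (associator_naturality := fun f g h => P.tensor_assoc f g h)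
    (leftUnitor_naturality := fun f => P.id_zero_tensor f)
    (rightUnitor_naturality := fun f =>
      ((P.comp_id _).trans (P.tensor_id_zero f)).trans (P.id_comp f).symm)
    (pentagon := fun a b c d => by
      change P.comp (P.tensor (P.eqHom _) (P.id _)) (P.comp (P.eqHom _)
        (P.tensor (P.id _) (P.eqHom _))) = P.comp (P.eqHom _) (P.eqHom _)
      rw [tensor_id_eqHom, tensor_eqHom_id, eqHom_comp_eqHom]
      erw [eqHom_comp_eqHom, eqHom_comp_eqHom])
    (triangle := fun a b => by
      change P.comp (P.eqHom (Nat.add_assoc a.val 0 b.val))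
        (P.tensor (P.id a.val) (P.eqHom (Nat.zero_add b.val))) =
          P.tensor (P.eqHom (Nat.add_zero a.val)) (P.id b.val)
      rw [tensor_id_eqHom, tensor_eqHom_id]
      erw [eqHom_comp_eqHom])

/-- The braiding of a prop, as an isomorphism. -/
def braidIso (X Y : P.Ob) : X ⊗ Y ≅ Y ⊗ X where
  hom := P.braid X.val Y.val
  inv := P.braid Y.val X.val
  hom_inv_id := P.braid_symm _ _
  inv_hom_id := P.braid_symm _ _

theorem braidIso_hexagon (X Y Z : P.Ob) :
    (α_ X Y Z).hom ≫ (P.braidIso X (Y ⊗ Z)).hom ≫ (α_ Y Z X).hom =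
      ((P.braidIso X Y).hom ▷ Z) ≫ (α_ Y X Z).hom ≫ (Y ◁ (P.braidIso X Z).hom) :=
  P.hexagon X.val Y.val Z.val

/-- The symmetry of a prop. -/
instance : SymmetricCategory P.Ob where
  braiding X Y := P.braidIso X Y
  braiding_naturality_right X _ _ f := P.braid_natural (P.id X.val) f
  braiding_naturality_left f Z := P.braid_natural f (P.id Z.val)
  hexagon_forward X Y Z := P.braidIso_hexagon X Y Z
  hexagon_reverse X Y Z := by
    have h : (α_ Z X Y ≪≫ P.braidIso Z (X ⊗ Y) ≪≫ α_ X Y Z) =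
        (whiskerRightIso (P.braidIso Z X) Y ≪≫ α_ X Z Y ≪≫ whiskerLeftIso X (P.braidIso Z Y)) :=
      Iso.ext (P.braidIso_hexagon Z X Y)
    have h' := congrArg Iso.inv h
    simp only [Iso.trans_inv, Category.assoc] at h'
    exact h'
  symmetry m n := P.braid_symm m.val n.val

end PROP

/-! ### Quotients by generated congruences -/

/-- The smallest congruence (for composition and tensor product) on `D` which contains `E` and
the laws of a prop. -/
inductive PropData.Cong (D : PropData.{w}) (E : ∀ {m n : ℕ}, D.Hom m n → D.Hom m n → Prop) :
    ∀ {m n : ℕ}, D.Hom m n → D.Hom m n → Prop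
  | of {m n : ℕ} {f g : D.Hom m n} : E f g → Cong D E f g
  | refl {m n : ℕ} (f : D.Hom m n) : Cong D E f f
  | symm {m n : ℕ} {f g : D.Hom m n} : Cong D E f g → Cong D E g f
  | trans {m n : ℕ} {f g h : D.Hom m n} : Cong D E f g → Cong D E g h → Cong D E f h
  | comp_congr {l m n : ℕ} {f f' : D.Hom l m} {g g' : D.Hom m n} :
      Cong D E f f' → Cong D E g g' → Cong D E (D.comp f g) (D.comp f' g')
  | tensor_congr {m n p q : ℕ} {f f' : D.Hom m n} {g g' : D.Hom p q} :
      Cong D E f f' → Cong D E g g' → Cong D E (D.tensor f g) (D.tensor f' g')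
  | id_comp {m n : ℕ} (f : D.Hom m n) : Cong D E (D.comp (D.id m) f) f
  | comp_id {m n : ℕ} (f : D.Hom m n) : Cong D E (D.comp f (D.id n)) f
  | assoc {k l m n : ℕ} (f : D.Hom k l) (g : D.Hom l m) (h : D.Hom m n) :
      Cong D E (D.comp (D.comp f g) h) (D.comp f (D.comp g h))
  | tensor_id (m n : ℕ) : Cong D E (D.tensor (D.id m) (D.id n)) (D.id (m + n))
  | tensor_comp {l m n p q r : ℕ} (f : D.Hom l m) (g : D.Hom m n) (f' : D.Hom p q)
      (g' : D.Hom q r) :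
      Cong D E (D.tensor (D.comp f g) (D.comp f' g')) (D.comp (D.tensor f f') (D.tensor g g'))
  | tensor_assoc {a b c a' b' c' : ℕ} (f : D.Hom a a') (g : D.Hom b b') (h : D.Hom c c') :
      Cong D E (D.comp (D.tensor (D.tensor f g) h) (D.eqHom (Nat.add_assoc a' b' c')))
        (D.comp (D.eqHom (Nat.add_assoc a b c)) (D.tensor f (D.tensor g h)))
  | id_zero_tensor {m n : ℕ} (f : D.Hom m n) :
      Cong D E (D.comp (D.tensor (D.id 0) f) (D.eqHom (Nat.zero_add n)))
        (D.comp (D.eqHom (Nat.zero_add m)) f)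
  | tensor_id_zero {m n : ℕ} (f : D.Hom m n) : Cong D E (D.tensor f (D.id 0)) f
  | braid_natural {m n p q : ℕ} (f : D.Hom m n) (g : D.Hom p q) :
      Cong D E (D.comp (D.tensor f g) (D.braid n q)) (D.comp (D.braid m p) (D.tensor g f))
  | braid_symm (m n : ℕ) : Cong D E (D.comp (D.braid m n) (D.braid n m)) (D.id (m + n))
  | hexagon (m n p : ℕ) :
      Cong D E
        (D.comp (D.eqHom (Nat.add_assoc m n p))
          (D.comp (D.braid m (n + p)) (D.eqHom (Nat.add_assoc n p m))))
        (D.comp (D.tensor (D.braid m n) (D.id p))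
          (D.comp (D.eqHom (Nat.add_assoc n m p)) (D.tensor (D.id n) (D.braid m p))))

/-- The operations induced on the quotient of `D` by the congruence `D.Cong E`. -/
def PropData.quotData (D : PropData.{w})
    (E : ∀ {m n : ℕ}, D.Hom m n → D.Hom m n → Prop) : PropData.{w} where
  Hom m n := Quot (D.Cong E (m := m) (n := n))
  id n := Quot.mk _ (D.id n)
  comp := Quot.map₂ D.comp (fun a _ _ h => .comp_congr (.refl a) h)
    (fun _ _ b h => .comp_congr h (.refl b))
  tensor := Quot.map₂ D.tensor (fun a _ _ h => .tensor_congr (.refl a) h)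
    (fun _ _ b h => .tensor_congr h (.refl b))
  braid m n := Quot.mk _ (D.braid m n)

theorem PropData.quotData_eqHom (D : PropData.{w})
    (E : ∀ {m n : ℕ}, D.Hom m n → D.Hom m n → Prop) {m n : ℕ} (h : m = n) :
    (D.quotData E).eqHom h = Quot.mk _ (D.eqHom h) := by
  subst h; rfl

/-- The prop obtained from `D` by dividing out the congruence generated by `E` and by the laws
of a prop. -/
def PropData.quotient (D : PropData.{w})
    (E : ∀ {m n : ℕ}, D.Hom m n → D.Hom m n → Prop) : PROP.{w} where
  toPropData := D.quotData E
  id_comp := by rintro m n ⟨f⟩; exact Quot.sound (.id_comp f)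
  comp_id := by rintro m n ⟨f⟩; exact Quot.sound (.comp_id f)
  assoc := by rintro k l m n ⟨f⟩ ⟨g⟩ ⟨h⟩; exact Quot.sound (.assoc f g h)
  tensor_id m n := Quot.sound (.tensor_id m n)
  tensor_comp := by
    rintro l m n p q r ⟨f⟩ ⟨g⟩ ⟨f'⟩ ⟨g'⟩; exact Quot.sound (.tensor_comp f g f' g')
  tensor_assoc := by
    rintro a b c a' b' c' ⟨f⟩ ⟨g⟩ ⟨h⟩
    rw [D.quotData_eqHom E, D.quotData_eqHom E]
    exact Quot.sound (.tensor_assoc f g h)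
  id_zero_tensor := by
    rintro m n ⟨f⟩
    rw [D.quotData_eqHom E, D.quotData_eqHom E]
    exact Quot.sound (.id_zero_tensor f)
  tensor_id_zero := by rintro m n ⟨f⟩; exact Quot.sound (.tensor_id_zero f)
  braid_natural := by rintro m n p q ⟨f⟩ ⟨g⟩; exact Quot.sound (.braid_natural f g)
  braid_symm m n := Quot.sound (.braid_symm m n)
  hexagon m n p := by
    rw [D.quotData_eqHom E, D.quotData_eqHom E, D.quotData_eqHom E]
    exact Quot.sound (.hexagon m n p)

/-! ### Symmetric monoidal theories -/

/-- The terms over a signature `Gen`, where `Gen m n` is the set of generators `m → n`.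
Identities and braidings of all arities are included as basic terms; composition is written in
diagrammatic order. -/
inductive Term (Gen : ℕ → ℕ → Type w) : ℕ → ℕ → Type w
  | gen {m n : ℕ} (σ : Gen m n) : Term Gen m n
  | id (n : ℕ) : Term Gen n n
  | braid (m n : ℕ) : Term Gen (m + n) (n + m)
  | comp {l m n : ℕ} (s : Term Gen l m) (t : Term Gen m n) : Term Gen l n
  | tensor {m n p q : ℕ} (s : Term Gen m n) (t : Term Gen p q) : Term Gen (m + p) (n + q)

/-- The terms over a signature with their (formal) operations. -/
def termData (Gen : ℕ → ℕ → Type w) : PropData.{w} where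
  Hom := Term Gen
  id := .id
  comp := .comp
  tensor := .tensor
  braid := .braid

/-- A symmetric monoidal theory: a signature and a set of equations, an equation being a pair of
terms of the same type. -/
structure Theory where
  Gen : ℕ → ℕ → Type w
  Eqn : ∀ {m n : ℕ}, Term Gen m n → Term Gen m n → Prop

/-- The prop presented by a theory: terms modulo the laws of a prop and the equations of the
theory. -/
def Theory.prop (T : Theory.{w}) : PROP.{w} :=
  (termData T.Gen).quotient T.Eqn

section Models

variable {C : Type u} [Category.{v} C] [MonoidalCategory C]

/-- The tensor power `X^{⊗ n}`, bracketed to the left. -/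
def pow (X : C) : ℕ → C
  | 0 => 𝟙_ C
  | n + 1 => pow X n ⊗ X

/-- The tensor power `f^{⊗ n}` of a morphism. -/
def powMap {X Y : C} (f : X ⟶ Y) : ∀ n : ℕ, pow X n ⟶ pow Y n
  | 0 => 𝟙 (𝟙_ C)
  | n + 1 => powMap f n ⊗ₘ f

/-- The canonical isomorphism `X^{⊗ (m + n)} ≅ X^{⊗ m} ⊗ X^{⊗ n}`. -/
def powAdd (X : C) (m : ℕ) : ∀ n : ℕ, pow X (m + n) ≅ pow X m ⊗ pow X n
  | 0 => (ρ_ (pow X m)).symm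
  | n + 1 => whiskerRightIso (powAdd X m n) X ≪≫ α_ (pow X m) (pow X n) X

/-- The interpretation of a term in a symmetric monoidal category, given the interpretation of
the generators. -/
def Term.eval [SymmetricCategory C] {Gen : ℕ → ℕ → Type w} (X : C)
    (op : ∀ {m n : ℕ}, Gen m n → (pow X m ⟶ pow X n)) :
    ∀ {m n : ℕ}, Term Gen m n → (pow X m ⟶ pow X n)
  | _, _, .gen σ => op σ
  | _, _, .id n => 𝟙 (pow X n)
  | _, _, .braid m n =>
      (powAdd X m n).hom ≫ (β_ (pow X m) (pow X n)).hom ≫ (powAdd X n m).inv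
  | _, _, .comp s t => s.eval X op ≫ t.eval X op
  | _, _, .tensor (m := m) (n := n) (p := p) (q := q) s t =>
      (powAdd X m p).hom ≫ (s.eval X op ⊗ₘ t.eval X op) ≫ (powAdd X n q).inv

variable (C) in
/-- A model of a theory in a symmetric monoidal category. -/
structure Model (T : Theory.{w}) [SymmetricCategory C] where
  X : C
  op : ∀ {m n : ℕ}, T.Gen m n → (pow X m ⟶ pow X n)
  sat : ∀ {m n : ℕ} {s t : Term T.Gen m n}, T.Eqn s t → s.eval X op = t.eval X op

theorem powMap_id (X : C) : ∀ n : ℕ, powMap (𝟙 X) n = 𝟙 (pow X n)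
  | 0 => rfl
  | n + 1 => by simp [powMap, pow, powMap_id X n]

theorem powMap_comp {X Y Z : C} (f : X ⟶ Y) (g : Y ⟶ Z) :
    ∀ n : ℕ, powMap (f ≫ g) n = powMap f n ≫ powMap g n
  | 0 => (Category.comp_id _).symm
  | n + 1 => by
    simp only [powMap, powMap_comp f g n]
    exact (MonoidalCategory.tensorHom_comp_tensorHom _ _ _ _).symm

variable [SymmetricCategory C]

/-- A morphism of models: a morphism of the underlying objects commuting with the operations. -/
@[ext]
structure Model.Hom {T : Theory.{w}} (M N : Model C T) where
  hom : M.X ⟶ N.X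
  comm : ∀ {m n : ℕ} (σ : T.Gen m n), M.op σ ≫ powMap hom n = powMap hom m ≫ N.op σ

/-- The category of models of a theory. -/
instance (T : Theory.{w}) : Category (Model C T) where
  Hom := Model.Hom
  id M := ⟨𝟙 M.X, fun σ => by simp [powMap_id]⟩
  comp f g := ⟨f.hom ≫ g.hom, fun σ => by
    rw [powMap_comp, powMap_comp, ← Category.assoc, f.comm, Category.assoc, g.comm,
      Category.assoc]⟩
  id_comp f := Model.Hom.ext (Category.id_comp f.hom)
  comp_id f := Model.Hom.ext (Category.comp_id f.hom)
  assoc f g h := Model.Hom.ext (Category.assoc f.hom g.hom h.hom)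

variable (C) in
/-- The underlying object of a model. -/
def Model.forget (T : Theory.{w}) : Model C T ⥤ C where
  obj M := M.X
  map f := Model.Hom.hom f

end Models

/-! ### Algebras of a prop -/

section Algebras

/-- A monoidal category is strict if its associator and unitors are identities. -/
class IsStrict (C : Type u) [Category.{v} C] [MonoidalCategory C] : Prop where
  associator (X Y Z : C) : ∃ h : (X ⊗ Y) ⊗ Z = X ⊗ (Y ⊗ Z), (α_ X Y Z).hom = eqToHom h
  leftUnitor (X : C) : ∃ h : 𝟙_ C ⊗ X = X, (λ_ X).hom = eqToHom h
  rightUnitor (X : C) : ∃ h : X ⊗ 𝟙_ C = X, (ρ_ X).hom = eqToHom h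

variable (P : PROP.{w}) (C : Type u) [Category.{v} C] [MonoidalCategory C] [SymmetricCategory C]

/-- An algebra of a prop in a symmetric monoidal category: a symmetric (strong) monoidal
functor. -/
structure Algebra where
  functor : P.Ob ⥤ C
  [braided : functor.Braided]

attribute [instance] Algebra.braided

variable {P C}

/-- A morphism of algebras: a monoidal natural transformation. -/
@[ext]
structure Algebra.Hom (F G : Algebra P C) where
  trans : F.functor ⟶ G.functor
  [isMonoidal : NatTrans.IsMonoidal trans]

attribute [instance] Algebra.Hom.isMonoidal

/-- The category of algebras of a prop. -/
instance : Category (Algebra P C) where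
  Hom := Algebra.Hom
  id F := ⟨𝟙 F.functor⟩
  comp f g := ⟨f.trans ≫ g.trans⟩
  id_comp f := Algebra.Hom.ext (Category.id_comp f.trans)
  comp_id f := Algebra.Hom.ext (Category.comp_id f.trans)
  assoc f g h := Algebra.Hom.ext (Category.assoc f.trans g.trans h.trans)

variable (P C)

/-- The underlying object of an algebra: its value at the generating object `1`. -/
def Algebra.evalOne : Algebra P C ⥤ C where
  obj F := F.functor.obj ⟨1⟩
  map f := (Algebra.Hom.trans f).app ⟨1⟩

open Functor.LaxMonoidal in
/-- An algebra is strict if the structure morphisms of its functor are identities. -/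
def Algebra.isStrict : ObjectProperty (Algebra P C) := fun F =>
  (∃ h : 𝟙_ C = F.functor.obj (𝟙_ P.Ob), ε F.functor = eqToHom h) ∧
    ∀ X Y : P.Ob, ∃ h : F.functor.obj X ⊗ F.functor.obj Y = F.functor.obj (X ⊗ Y),
      μ F.functor X Y = eqToHom h

end Algebras

/-- `P` is the prop for the theory `T`: in every symmetric monoidal category `C`, the category of
algebras of `P` is equivalent to the category of models of `T`, compatibly with underlying
objects; and when `C` is strict, so is the category of strict algebras of `P`. -/
def IsPropFor (P : PROP.{w}) (T : Theory.{w}) : Prop :=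
  ∀ (C : Type u) [Category.{v} C] [MonoidalCategory C] [SymmetricCategory C],
    (∃ E : Algebra P C ≌ Model C T,
      Nonempty (E.functor ⋙ Model.forget C T ≅ Algebra.evalOne P C)) ∧
    (IsStrict C → ∃ E : (Algebra.isStrict P C).FullSubcategory ≌ Model C T,
      Nonempty (E.functor ⋙ Model.forget C T ≅
        (Algebra.isStrict P C).ι ⋙ Algebra.evalOne P C))

/-! ### The theory of special bicommutative bimonoids -/

namespace SBB

/-- The generators of the theory of bimonoids. -/
inductive Gen : ℕ → ℕ → Type
  | mul : Gen 2 1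
  | unit : Gen 0 1
  | comul : Gen 1 2
  | counit : Gen 1 0

/-- The multiplication `μ : 2 → 1`. -/
abbrev mul : Term Gen 2 1 := .gen .mul

/-- The unit `η : 0 → 1`. -/
abbrev unit : Term Gen 0 1 := .gen .unit

/-- The comultiplication `δ : 1 → 2`. -/
abbrev comul : Term Gen 1 2 := .gen .comul

/-- The counit `ε : 1 → 0`. -/
abbrev counit : Term Gen 1 0 := .gen .counit

/-- The identity `1 → 1`. -/
abbrev one : Term Gen 1 1 := .id 1

/-- The braiding `2 → 2`. -/
abbrev swap : Term Gen 2 2 := .braid 1 1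

/-- The braiding of the two middle strands, `4 → 4`. -/
abbrev exch : Term Gen 4 4 :=
  .tensor (m := 1) (n := 1) (p := 3) (q := 3) one (.tensor (m := 2) (n := 2) swap one)

/-- The equations of the theory of special bicommutative bimonoids. -/
inductive Eqn : ∀ {m n : ℕ}, Term Gen m n → Term Gen m n → Prop
  -- commutative monoid
  | assoc : Eqn (m := 3) (n := 1) (.comp (.tensor mul one) mul) (.comp (.tensor one mul) mul)
  | unit_left : Eqn (m := 1) (n := 1) (.comp (.tensor unit one) mul) one
  | comm : Eqn (m := 2) (n := 1) (.comp swap mul) mul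
  -- cocommutative comonoid
  | coassoc : Eqn (m := 1) (n := 3) (.comp comul (.tensor comul one))
      (.comp comul (.tensor one comul))
  | counit_left : Eqn (m := 1) (n := 1) (.comp comul (.tensor counit one)) one
  | cocomm : Eqn (m := 1) (n := 2) (.comp comul swap) comul
  -- bimonoid laws
  | mul_comul : Eqn (m := 2) (n := 2) (.comp mul comul)
      (.comp (.tensor comul comul) (.comp exch (.tensor mul mul)))
  | mul_counit : Eqn (m := 2) (n := 0) (.comp mul counit) (.tensor counit counit)
  | unit_comul : Eqn (m := 0) (n := 2) (.comp unit comul) (.tensor unit unit)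
  -- extra law
  | extra : Eqn (m := 0) (n := 0) (.comp unit counit) (.id 0)
  -- special law
  | special : Eqn (m := 1) (n := 1) (.comp comul mul) one

end SBB

/-- The symmetric monoidal theory of special bicommutative bimonoids. -/
def sbb : Theory.{0} where
  Gen := SBB.Gen
  Eqn := SBB.Eqn

/-! ### Finite sets and relations -/

section LiftRel

variable {α β γ α' β' γ' α'' β'' : Type} {r : α → α' → Prop} {s : β → β' → Prop}
  {t : γ → γ' → Prop} {r' : α' → α'' → Prop} {s' : β' → β'' → Prop}

theorem liftRel_eq (x y : α ⊕ β) : Sum.LiftRel (· = ·) (· = ·) x y ↔ x = y := by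
  rcases x with x | x <;> rcases y with y | y <;> simp

theorem liftRel_comp (x : α ⊕ β) (y : α'' ⊕ β'') :
    Relation.Comp (Sum.LiftRel r s) (Sum.LiftRel r' s') x y ↔
      Sum.LiftRel (Relation.Comp r r') (Relation.Comp s s') x y := by
  rcases x with x | x <;> rcases y with y | y <;> simp [Relation.Comp]

theorem liftRel_assoc (x : (α ⊕ β) ⊕ γ) (y : α' ⊕ (β' ⊕ γ')) :
    Sum.LiftRel (Sum.LiftRel r s) t x ((Equiv.sumAssoc α' β' γ').symm y) ↔
      Sum.LiftRel r (Sum.LiftRel s t) (Equiv.sumAssoc α β γ x) y := by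
  rcases x with (x | x) | x <;> rcases y with y | y | y <;> simp

theorem liftRel_empty_left (q : Empty → Empty → Prop) (x : Empty ⊕ α) (y : α') :
    Sum.LiftRel q r x ((Equiv.emptySum Empty α').symm y) ↔ r (Equiv.emptySum Empty α x) y := by
  rcases x with x | x
  · exact x.elim
  · simp

theorem liftRel_empty_right (q : Empty → Empty → Prop) (x : α ⊕ Empty) (y : α') :
    Sum.LiftRel r q x ((Equiv.sumEmpty α' Empty).symm y) ↔ r (Equiv.sumEmpty α Empty x) y := by
  rcases x with x | x
  · simp
  · exact x.elim

theorem liftRel_swap (x : α ⊕ β) (y : β' ⊕ α') :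
    Sum.LiftRel r s x ((Equiv.sumComm α' β').symm y) ↔
      Sum.LiftRel s r (Equiv.sumComm α β x) y := by
  rcases x with x | x <;> rcases y with y | y <;> simp

theorem liftRel_graph (e : α ≃ α') (e' : β ≃ β') (x : α ⊕ β) (y : α' ⊕ β') :
    Sum.LiftRel (fun a b => e a = b) (fun a b => e' a = b) x y ↔ e.sumCongr e' x = y := by
  rcases x with x | x <;> rcases y with y | y <;> simp

end LiftRel

/-- A finite set, as an object of the category of finite sets and relations. -/
structure FinRel where
  carrier : Type
  [finite : Finite carrier]

attribute [instance] FinRel.finite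

namespace FinRel

/-- The category of finite sets and binary relations. -/
instance : Category FinRel where
  Hom X Y := X.carrier → Y.carrier → Prop
  id _ := fun x y => x = y
  comp R S := Relation.Comp R S
  id_comp _ := Relation.eq_comp
  comp_id _ := Relation.comp_eq
  assoc _ _ _ := Relation.comp_assoc

/-- The graph of a bijection, as an isomorphism in the category of relations. -/
def graphIso {X Y : FinRel} (e : X.carrier ≃ Y.carrier) : X ≅ Y where
  hom := fun x y => e x = y
  inv := fun y x => e.symm y = x
  hom_inv_id := by
    funext x y
    simp [CategoryStruct.comp, CategoryStruct.id, Relation.Comp]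
  inv_hom_id := by
    funext x y
    simp [CategoryStruct.comp, CategoryStruct.id, Relation.Comp]

instance : MonoidalCategoryStruct FinRel where
  tensorObj X Y := ⟨X.carrier ⊕ Y.carrier⟩
  tensorUnit := ⟨Empty⟩
  tensorHom R S := Sum.LiftRel R S
  whiskerLeft _ _ _ S := Sum.LiftRel (· = ·) S
  whiskerRight R _ := Sum.LiftRel R (· = ·)
  associator X Y Z := graphIso (Equiv.sumAssoc X.carrier Y.carrier Z.carrier)
  leftUnitor X := graphIso (Equiv.emptySum Empty X.carrier)
  rightUnitor X := graphIso (Equiv.sumEmpty X.carrier Empty)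

theorem hom_ext {X Y : FinRel} {R S : X ⟶ Y} (h : ∀ x y, R x y ↔ S x y) : R = S :=
  funext fun x => funext fun y => propext (h x y)

theorem comp_graphIso {X Y Z : FinRel} (R : X ⟶ Y) (e : Y.carrier ≃ Z.carrier)
    (x : X.carrier) (z : Z.carrier) : (R ≫ (graphIso e).hom) x z ↔ R x (e.symm z) :=
  ⟨fun ⟨y, h, h'⟩ => by
    have h' : e y = z := h'
    subst h'; simpa using h, fun h => ⟨e.symm z, h, e.apply_symm_apply z⟩⟩

theorem graphIso_comp {X Y Z : FinRel} (e : X.carrier ≃ Y.carrier) (R : Y ⟶ Z)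
    (x : X.carrier) (z : Z.carrier) : ((graphIso e).hom ≫ R) x z ↔ R (e x) z :=
  ⟨fun ⟨y, h, h'⟩ => by
    have h : e x = y := h
    subst h; exact h', fun h => ⟨e x, rfl, h⟩⟩

theorem natural_of {X Y Z W : FinRel} (e : X.carrier ≃ Y.carrier) (e' : Z.carrier ≃ W.carrier)
    (R : X ⟶ Z) (S : Y ⟶ W) (h : ∀ x w, R x (e'.symm w) ↔ S (e x) w) :
    R ≫ (graphIso e').hom = (graphIso e).hom ≫ S :=
  hom_ext fun x w =>
    (comp_graphIso R e' x w).trans ((h x w).trans (graphIso_comp e S x w).symm)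

theorem graphIso_comp_graphIso {X Y Z : FinRel} (e : X.carrier ≃ Y.carrier)
    (e' : Y.carrier ≃ Z.carrier) :
    (graphIso e).hom ≫ (graphIso e').hom = (graphIso (e.trans e')).hom :=
  hom_ext fun x z => graphIso_comp e _ x z

theorem tensor_graphIso {X Y Z W : FinRel} (e : X.carrier ≃ Y.carrier)
    (e' : Z.carrier ≃ W.carrier) :
    ((graphIso e).hom ⊗ₘ (graphIso e').hom) =
      (graphIso (X := X ⊗ Z) (Y := Y ⊗ W) (e.sumCongr e')).hom :=
  hom_ext fun a b => liftRel_graph e e' a b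

theorem tensor_graphIso_id {X Y : FinRel} (e : X.carrier ≃ Y.carrier) (Z : FinRel) :
    ((graphIso e).hom ⊗ₘ 𝟙 Z) =
      (graphIso (X := X ⊗ Z) (Y := Y ⊗ Z) (e.sumCongr (Equiv.refl _))).hom :=
  tensor_graphIso e (Equiv.refl _)

theorem tensor_id_graphIso {X Y : FinRel} (e : X.carrier ≃ Y.carrier) (Z : FinRel) :
    (𝟙 Z ⊗ₘ (graphIso e).hom) =
      (graphIso (X := Z ⊗ X) (Y := Z ⊗ Y) ((Equiv.refl _).sumCongr e)).hom :=
  tensor_graphIso (Equiv.refl _) e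

theorem graphIso_congr {X Y : FinRel} {e e' : X.carrier ≃ Y.carrier} (h : ∀ x, e x = e' x) :
    (graphIso e).hom = (graphIso e').hom := by
  rw [Equiv.ext h]

/-- The monoidal structure given by disjoint union. -/
instance : MonoidalCategory FinRel :=
  MonoidalCategory.ofTensorHom
    (id_tensorHom_id := fun _ _ => hom_ext fun a b => liftRel_eq a b)
    (id_tensorHom := fun _ _ _ _ => rfl)
    (tensorHom_id := fun _ _ => rfl)
    (tensorHom_comp_tensorHom := fun _ _ _ _ => hom_ext fun a b => liftRel_comp a b)
    (associator_naturality := fun _ _ _ => natural_of _ _ _ _ fun x w => liftRel_assoc x w)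
    (leftUnitor_naturality := fun _ => natural_of _ _ _ _ fun x w => liftRel_empty_left _ x w)
    (rightUnitor_naturality := fun _ => natural_of _ _ _ _ fun x w => liftRel_empty_right _ x w)
    (pentagon := fun a b c d => by
      refine (congrArg₂ (· ≫ ·) (tensor_graphIso_id _ _)
        (congrArg₂ (· ≫ ·) rfl (tensor_id_graphIso _ _))).trans ?_
      refine (congrArg₂ (· ≫ ·) rfl (graphIso_comp_graphIso _ _)).trans ?_
      refine (graphIso_comp_graphIso _ _).trans (Eq.trans ?_ (graphIso_comp_graphIso _ _).symm)
      exact graphIso_congr (by rintro (((x | x) | x) | x) <;> rfl))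
    (triangle := fun a b => by
      refine (congrArg₂ (· ≫ ·) rfl (tensor_id_graphIso _ _)).trans ?_
      refine (graphIso_comp_graphIso _ _).trans (Eq.trans ?_ (tensor_graphIso_id _ _).symm)
      exact graphIso_congr (by
        rintro ((x | x) | x)
        · rfl
        · exact x.elim
        · rfl))

/-- The exchange of the two summands of a disjoint union. -/
def swapIso (X Y : FinRel) : X ⊗ Y ≅ Y ⊗ X :=
  graphIso (X := X ⊗ Y) (Y := Y ⊗ X) (Equiv.sumComm X.carrier Y.carrier)

theorem swapIso_symmetry (X Y : FinRel) :
    (swapIso X Y).hom ≫ (swapIso Y X).hom = 𝟙 (X ⊗ Y) :=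
  (graphIso_comp_graphIso _ _).trans
    (graphIso_congr (e' := Equiv.refl _) (by rintro (x | x) <;> rfl))

theorem swapIso_hexagon (X Y Z : FinRel) :
    (α_ X Y Z).hom ≫ (swapIso X (Y ⊗ Z)).hom ≫ (α_ Y Z X).hom =
      ((swapIso X Y).hom ▷ Z) ≫ (α_ Y X Z).hom ≫ (Y ◁ (swapIso X Z).hom) := by
  refine (congrArg₂ (· ≫ ·) rfl (graphIso_comp_graphIso _ _)).trans ?_
  refine (graphIso_comp_graphIso _ _).trans (Eq.symm ?_)
  refine (congrArg₂ (· ≫ ·) (tensor_graphIso_id _ _)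
    (congrArg₂ (· ≫ ·) rfl (tensor_id_graphIso _ _))).trans ?_
  refine (congrArg₂ (· ≫ ·) rfl (graphIso_comp_graphIso _ _)).trans ?_
  refine (graphIso_comp_graphIso _ _).trans ?_
  exact graphIso_congr (by rintro ((x | x) | x) <;> rfl)

/-- The symmetry exchanging the two summands of a disjoint union. -/
instance : SymmetricCategory FinRel where
  braiding := swapIso
  braiding_naturality_right _ _ _ _ := natural_of _ _ _ _ fun x w => liftRel_swap x w
  braiding_naturality_left _ _ := natural_of _ _ _ _ fun x w => liftRel_swap x w
  hexagon_forward := swapIso_hexagon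
  hexagon_reverse X Y Z := by
    have h : (α_ Z X Y ≪≫ swapIso Z (X ⊗ Y) ≪≫ α_ X Y Z) =
        (whiskerRightIso (swapIso Z X) Y ≪≫ α_ X Z Y ≪≫ whiskerLeftIso X (swapIso Z Y)) :=
      Iso.ext (swapIso_hexagon Z X Y)
    have h' := congrArg Iso.inv h
    simp only [Iso.trans_inv, Category.assoc] at h'
    exact h'
  symmetry := swapIso_symmetry

end FinRel

/-! ### The prop of relations -/

namespace RelProp

/-- Relations between the finite sets `Fin m`, with relational composition; the tensor product and
the braiding are those of disjoint unions, under `Fin m ⊕ Fin n ≃ Fin (m + n)`. -/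
def data : PropData.{0} where
  Hom m n := Fin m → Fin n → Prop
  id _ := fun i j => i = j
  comp R S := Relation.Comp R S
  tensor R S := fun i j => Sum.LiftRel R S (finSumFinEquiv.symm i) (finSumFinEquiv.symm j)
  braid _ _ := fun i j => (finSumFinEquiv.symm i).swap = finSumFinEquiv.symm j

theorem hom_ext {m n : ℕ} {R S : data.Hom m n} (h : ∀ x y, R x y ↔ S x y) : R = S :=
  funext fun x => funext fun y => propext (h x y)

theorem eqHom_comp {l m n : ℕ} (h : l = m) (R : data.Hom m n) (i : Fin l) (j : Fin n) :
    data.comp (data.eqHom h) R i j ↔ R (Fin.cast h i) j := by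
  subst h
  exact iff_of_eq (congrFun (congrFun (Relation.eq_comp (r := R)) i) j)

theorem comp_eqHom {l m n : ℕ} (h : m = n) (R : data.Hom l m) (i : Fin l) (j : Fin n) :
    data.comp R (data.eqHom h) i j ↔ R i (Fin.cast h.symm j) := by
  subst h
  exact iff_of_eq (congrFun (congrFun (Relation.comp_eq (r := R)) i) j)

theorem tensor_iff {m n p q : ℕ} (R : data.Hom m n) (S : data.Hom p q) (i : Fin (m + p))
    (j : Fin (n + q)) : data.tensor R S i j ↔
      Sum.LiftRel R S (finSumFinEquiv.symm i) (finSumFinEquiv.symm j) := Iff.rfl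

theorem tensor_ll {m n p q : ℕ} (R : data.Hom m n) (S : data.Hom p q) (i : Fin m) (j : Fin n) :
    data.tensor R S (Fin.castAdd p i) (Fin.castAdd q j) ↔ R i j := by
  rw [tensor_iff, finSumFinEquiv_symm_apply_castAdd,
    finSumFinEquiv_symm_apply_castAdd]
  exact Sum.liftRel_inl_inl

theorem tensor_lr {m n p q : ℕ} (R : data.Hom m n) (S : data.Hom p q) (i : Fin m) (j : Fin q) :
    data.tensor R S (Fin.castAdd p i) (Fin.natAdd n j) ↔ False := by
  rw [tensor_iff, finSumFinEquiv_symm_apply_castAdd,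
    finSumFinEquiv_symm_apply_natAdd]
  exact iff_false_intro Sum.not_liftRel_inl_inr

theorem tensor_rl {m n p q : ℕ} (R : data.Hom m n) (S : data.Hom p q) (i : Fin p) (j : Fin n) :
    data.tensor R S (Fin.natAdd m i) (Fin.castAdd q j) ↔ False := by
  rw [tensor_iff, finSumFinEquiv_symm_apply_natAdd,
    finSumFinEquiv_symm_apply_castAdd]
  exact iff_false_intro Sum.not_liftRel_inr_inl

theorem tensor_rr {m n p q : ℕ} (R : data.Hom m n) (S : data.Hom p q) (i : Fin p) (j : Fin q) :
    data.tensor R S (Fin.natAdd m i) (Fin.natAdd n j) ↔ S i j := by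
  rw [tensor_iff, finSumFinEquiv_symm_apply_natAdd,
    finSumFinEquiv_symm_apply_natAdd]
  exact Sum.liftRel_inr_inr

theorem comp_braid {l m n : ℕ} (R : data.Hom l (m + n)) (i : Fin l) (j : Fin (n + m)) :
    data.comp R (data.braid m n) i j ↔ R i (finSumFinEquiv (finSumFinEquiv.symm j).swap) := by
  constructor
  · rintro ⟨k, h, h'⟩
    have h' : (finSumFinEquiv.symm k).swap = finSumFinEquiv.symm j := h'
    rw [← h']; simpa using h
  · intro h
    refine ⟨_, h, ?_⟩
    change (finSumFinEquiv.symm (finSumFinEquiv _)).swap = _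
    simp

theorem braid_comp {l m n : ℕ} (R : data.Hom (n + m) l) (i : Fin (m + n)) (j : Fin l) :
    data.comp (data.braid m n) R i j ↔ R (finSumFinEquiv (finSumFinEquiv.symm i).swap) j := by
  constructor
  · rintro ⟨k, h, h'⟩
    have h : (finSumFinEquiv.symm i).swap = finSumFinEquiv.symm k := h
    rw [h]; simpa using h'
  · intro h
    refine ⟨_, ?_, h⟩
    change (finSumFinEquiv.symm i).swap = finSumFinEquiv.symm (finSumFinEquiv _)
    simp

theorem tensor_braid_id_comp {m n p l : ℕ} (R : data.Hom (n + m + p) l) (i : Fin (m + n + p))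
    (j : Fin l) : data.comp (data.tensor (data.braid m n) (data.id p)) R i j ↔
      R (finSumFinEquiv (Sum.map (fun k => finSumFinEquiv (finSumFinEquiv.symm k).swap) id
        (finSumFinEquiv.symm i))) j := by
  have key : ∀ k, data.tensor (data.braid m n) (data.id p) i k ↔
      finSumFinEquiv (Sum.map (fun k => finSumFinEquiv (finSumFinEquiv.symm k).swap) id
        (finSumFinEquiv.symm i)) = k := by
    intro k
    rw [tensor_iff, ← Equiv.eq_symm_apply finSumFinEquiv]
    rcases finSumFinEquiv.symm i with x | x <;> rcases finSumFinEquiv.symm k with y | y <;>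
      simp [data, Equiv.eq_symm_apply]
  exact ⟨fun ⟨k, h, h'⟩ => by rwa [(key k).1 h], fun h => ⟨_, (key _).2 rfl, h⟩⟩

theorem cast_left {a b c : ℕ} (h : a + b + c = a + (b + c)) (x : Fin a) :
    Fin.cast h (Fin.castAdd c (Fin.castAdd b x)) = Fin.castAdd (b + c) x := rfl

theorem cast_mid {a b c : ℕ} (h : a + b + c = a + (b + c)) (x : Fin b) :
    Fin.cast h (Fin.castAdd c (Fin.natAdd a x)) = Fin.natAdd a (Fin.castAdd c x) := rfl

theorem cast_right {a b c : ℕ} (h : a + b + c = a + (b + c)) (x : Fin c) :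
    Fin.cast h (Fin.natAdd (a + b) x) = Fin.natAdd a (Fin.natAdd b x) :=
  Fin.ext (Nat.add_assoc a b x)

theorem cast_left' {a b c : ℕ} (h : a + (b + c) = a + b + c) (x : Fin a) :
    Fin.cast h (Fin.castAdd (b + c) x) = Fin.castAdd c (Fin.castAdd b x) := rfl

theorem cast_mid' {a b c : ℕ} (h : a + (b + c) = a + b + c) (x : Fin b) :
    Fin.cast h (Fin.natAdd a (Fin.castAdd c x)) = Fin.castAdd c (Fin.natAdd a x) := rfl

theorem cast_right' {a b c : ℕ} (h : a + (b + c) = a + b + c) (x : Fin c) :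
    Fin.cast h (Fin.natAdd a (Fin.natAdd b x)) = Fin.natAdd (a + b) x :=
  Fin.ext (Nat.add_assoc a b x).symm

/-- Induction over the three summands of `Fin (a + b + c)`. -/
theorem cases₃ {a b c : ℕ} {q : Fin (a + b + c) → Prop}
    (h₁ : ∀ x, q (Fin.castAdd c (Fin.castAdd b x))) (h₂ : ∀ x, q (Fin.castAdd c (Fin.natAdd a x)))
    (h₃ : ∀ x, q (Fin.natAdd (a + b) x)) (x) : q x :=
  Fin.addCases (Fin.addCases h₁ h₂) h₃ x

/-- Induction over the three summands of `Fin (a + (b + c))`. -/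
theorem cases₃' {a b c : ℕ} {q : Fin (a + (b + c)) → Prop}
    (h₁ : ∀ x, q (Fin.castAdd (b + c) x)) (h₂ : ∀ x, q (Fin.natAdd a (Fin.castAdd c x)))
    (h₃ : ∀ x, q (Fin.natAdd a (Fin.natAdd b x))) (x) : q x :=
  Fin.addCases h₁ (Fin.addCases h₂ h₃) x

end RelProp

open RelProp in
/-- The prop of relations between finite sets. -/
def relProp : PROP.{0} where
  toPropData := RelProp.data
  id_comp _ := Relation.eq_comp
  comp_id _ := Relation.comp_eq
  assoc _ _ _ := Relation.comp_assoc
  tensor_id m n := hom_ext fun i j =>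
    (liftRel_eq _ _).trans finSumFinEquiv.symm.injective.eq_iff
  tensor_comp f g f' g' := hom_ext fun i j => by
    refine (liftRel_comp _ _).symm.trans ?_
    exact finSumFinEquiv.exists_congr_left.trans Iff.rfl
  tensor_assoc f g h := hom_ext fun i j => by
    rw [comp_eqHom, eqHom_comp]
    induction i using cases₃ <;> induction j using cases₃' <;>
      simp only [cast_left, cast_mid, cast_right, cast_left', cast_mid', cast_right',
        tensor_ll, tensor_lr, tensor_rl, tensor_rr]
  id_zero_tensor {m n} f := hom_ext fun i j => by
    rw [comp_eqHom, eqHom_comp]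
    induction i using Fin.addCases with
    | left i => exact i.elim0
    | right i =>
      have hi : Fin.cast (Nat.zero_add m) (Fin.natAdd 0 i) = i := Fin.ext (Nat.zero_add _)
      have hj : Fin.cast (Nat.zero_add n).symm j = Fin.natAdd 0 j :=
        Fin.ext (Nat.zero_add _).symm
      rw [hi, hj, tensor_rr]
  tensor_id_zero f := hom_ext fun i j => tensor_ll f (data.id 0) i j
  braid_natural f g := hom_ext fun i j => by
    rw [comp_braid, braid_comp, tensor_iff, tensor_iff, Equiv.symm_apply_apply,
      Equiv.symm_apply_apply]
    exact liftRel_swap _ _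
  braid_symm m n := hom_ext fun i j => by
    rw [comp_braid]
    change (finSumFinEquiv.symm i).swap = finSumFinEquiv.symm (finSumFinEquiv _) ↔ i = j
    simp [Sum.swap_leftInverse.injective.eq_iff]
  hexagon m n p := hom_ext fun i j => by
    rw [eqHom_comp, comp_eqHom, tensor_braid_id_comp, eqHom_comp]
    induction i using cases₃ <;> induction j using cases₃' <;>
      simp [cast_left, cast_mid, cast_right, cast_left', cast_mid', cast_right',
        data]
    · exact fun h => absurd (congrArg Fin.val h) (by simp; omega)
    · exact fun h => absurd (congrArg Fin.val h) (by simp; omega)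

end SymMonTheory

/-! The second statement holds for every symmetric monoidal theory. A model on `X` interprets a term
`m → n` as a morphism `X^{⊗m} → X^{⊗n}`; coherence of tensor powers (`powAdd_assoc`,
`powAdd_zero_left`, `pow_hexagon`) makes this respect the laws of a prop, so it descends to a
braided monoidal functor on the presented prop. This assignment is fully faithful, because a
monoidal transformation is determined by its component at `1`. It is essentially surjective, because
the tensor structure of an algebra `F` gives `F(1)^{⊗n} ≅ F(n)`, under which `F` becomes evaluation
of terms (`Algebra.eval_eq`). When `C` is strict the functor built from a model is itself strict.

For the isomorphism of props, every generator is sent to the total relation of its type. Fullness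
(`SBB.definable`): a relation into `n + 1` is the pairing, along a definable duplication, of a
relation into `n` and one into `1`; converses of definable relations are definable, so everything
reduces to relations `1 → 1`.

Faithfulness rests on the product-like behaviour of tensor products of comonoids. By the bimonoid
laws and cocommutativity every term is interpreted by a comonoid morphism, and a comonoid morphism
into `X^{⊗n}` is determined by its `n` projections (`powProj_ext`). The morphisms from a
cocommutative comonoid to `X` form a commutative monoid under convolution, in which comonoid
morphisms are idempotent by the special law. Hence the `j`-th component of a term is the product of
the projections indexed by the points related to `j` (`SBB.eval_powProj`); idempotence makes the
number of paths between two points irrelevant. So the interpretation depends only on the relation.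
Taking for `X` the generating object of the presented prop itself, where a term is interpreted by
its own class up to canonical isomorphism, gives injectivity.

For the first statement, `n ↦ Fin n` is fully faithful by construction, and its coherence conditions
compare graphs of bijections. -/

namespace SymMonTheory

/-! ### Coherence of tensor powers -/

section PowCoherence

variable {C : Type u} [Category.{v} C] [MonoidalCategory C] (X : C)

theorem eqToHom_pow_succ {m n : ℕ} (h : m = n) :
    eqToHom (congrArg (pow X) (congrArg Nat.succ h)) =
      eqToHom (congrArg (pow X) h) ▷ X := by
  subst h
  exact (id_whiskerRight _ _).symm

theorem powAdd_succ_hom (m n : ℕ) : (powAdd X m (n + 1)).hom =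
    (powAdd X m n).hom ▷ X ≫ (α_ (pow X m) (pow X n) X).hom := rfl

/-- Induction on the last exponent, the one along which `powAdd` recurses; the step is the pentagon
together with naturality of the associator. -/
theorem powAdd_assoc (a b c : ℕ) :
    (powAdd X (a + b) c).hom ≫ (powAdd X a b).hom ▷ pow X c ≫ (α_ _ _ _).hom =
      eqToHom (congrArg (pow X) (Nat.add_assoc a b c)) ≫ (powAdd X a (b + c)).hom ≫
        pow X a ◁ (powAdd X b c).hom := by
  induction c with
  | zero =>
    change (ρ_ (pow X (a + b))).inv ≫ (powAdd X a b).hom ▷ 𝟙_ C ≫ (α_ _ _ _).hom =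
      𝟙 _ ≫ (powAdd X a b).hom ≫ pow X a ◁ (ρ_ (pow X b)).inv
    simp
  | succ c ih =>
    have ih' := congrArg (· ▷ X) ih
    simp only [comp_whiskerRight] at ih'
    erw [eqToHom_pow_succ X (Nat.add_assoc a b c)]
    change ((powAdd X (a + b) c).hom ▷ X ≫ (α_ _ _ _).hom) ≫
      (powAdd X a b).hom ▷ (pow X c ⊗ X) ≫ (α_ _ _ _).hom = _ ≫
      ((powAdd X a (b + c)).hom ▷ X ≫ (α_ _ _ _).hom) ≫ pow X a ◁
        ((powAdd X b c).hom ▷ X ≫ (α_ _ _ _).hom)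
    simp only [Category.assoc, MonoidalCategory.whiskerLeft_comp]
    rw [← associator_naturality_middle_assoc, ← reassoc_of% ih', pentagon,
      ← associator_naturality_left_assoc]

/-- Addition recurses on its second argument, so `0 + n = n` is not definitional and a transport has
to be identified with the left unitor. -/
theorem powAdd_zero_left (n : ℕ) :
    (powAdd X 0 n).hom ≫ (λ_ (pow X n)).hom =
      eqToHom (congrArg (pow X) (Nat.zero_add n)) := by
  induction n with
  | zero => exact (congrArg (_ ≫ ·) (unitors_equal (C := C))).trans (Iso.inv_hom_id _)
  | succ n ih =>
    erw [eqToHom_pow_succ X (Nat.zero_add n)]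
    rw [← ih, powAdd_succ_hom]
    simp [pow]

theorem pow_id_zero_tensor {m n : ℕ} (f : pow X m ⟶ pow X n) :
    ((powAdd X 0 m).hom ≫ (𝟙 (𝟙_ C) ⊗ₘ f) ≫ (powAdd X 0 n).inv) ≫
      eqToHom (congrArg (pow X) (Nat.zero_add n)) =
    eqToHom (congrArg (pow X) (Nat.zero_add m)) ≫ f := by
  have key : ∀ {A B A' B' : C} (e : A ≅ 𝟙_ C ⊗ B) (e' : A' ≅ 𝟙_ C ⊗ B') (f : B ⟶ B'),
      (e.hom ≫ (𝟙 (𝟙_ C) ⊗ₘ f) ≫ e'.inv) ≫ e'.hom ≫ (λ_ B').hom =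
        (e.hom ≫ (λ_ B).hom) ≫ f := by
    intros; simp
  rw [← powAdd_zero_left, ← powAdd_zero_left]
  exact key (powAdd X 0 m) (powAdd X 0 n) f

theorem pow_tensor_assoc {a b c a' b' c' : ℕ} (f : pow X a ⟶ pow X a')
    (g : pow X b ⟶ pow X b') (h : pow X c ⟶ pow X c') :
    ((powAdd X (a + b) c).hom ≫
      (((powAdd X a b).hom ≫ (f ⊗ₘ g) ≫ (powAdd X a' b').inv) ⊗ₘ h) ≫
        (powAdd X (a' + b') c').inv) ≫ eqToHom (congrArg (pow X) (Nat.add_assoc a' b' c')) =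
    eqToHom (congrArg (pow X) (Nat.add_assoc a b c)) ≫ (powAdd X a (b + c)).hom ≫
      (f ⊗ₘ ((powAdd X b c).hom ≫ (g ⊗ₘ h) ≫ (powAdd X b' c').inv)) ≫
        (powAdd X a' (b' + c')).inv := by
  -- After splitting the target into three powers, `powAdd_assoc` replaces the transports by
  -- associators and only naturality of the associator is left.
  rw [← cancel_mono ((powAdd X a' (b' + c')).hom ≫ pow X a' ◁ (powAdd X b' c').hom)]
  simp only [Category.assoc]
  rw [← powAdd_assoc, Iso.inv_hom_id_assoc, Iso.inv_hom_id_assoc, tensorHom_comp_whiskerLeft,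
    tensorHom_comp_whiskerRight_assoc]
  simp only [Category.assoc, Iso.inv_hom_id, Category.comp_id]
  rw [← whiskerLeft_comp_tensorHom, ← whiskerRight_comp_tensorHom_assoc, associator_naturality]
  exact (reassoc_of% (powAdd_assoc X a b c)) _

end PowCoherence

/-- Splitting the target into three powers reduces this to the hexagon of `C` and naturality of its
braiding. -/
theorem pow_hexagon {C : Type u} [Category.{v} C] [MonoidalCategory C] [SymmetricCategory C]
    (X : C) (m n p : ℕ) :
    eqToHom (congrArg (pow X) (Nat.add_assoc m n p)) ≫
      ((powAdd X m (n + p)).hom ≫ (β_ (pow X m) (pow X (n + p))).hom ≫ (powAdd X (n + p) m).inv) ≫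
        eqToHom (congrArg (pow X) (Nat.add_assoc n p m)) =
    ((powAdd X (m + n) p).hom ≫
      (((powAdd X m n).hom ≫ (β_ (pow X m) (pow X n)).hom ≫ (powAdd X n m).inv) ⊗ₘ 𝟙 (pow X p)) ≫
        (powAdd X (n + m) p).inv) ≫ eqToHom (congrArg (pow X) (Nat.add_assoc n m p)) ≫
      (powAdd X n (m + p)).hom ≫ (𝟙 (pow X n) ⊗ₘ
        ((powAdd X m p).hom ≫ (β_ (pow X m) (pow X p)).hom ≫ (powAdd X p m).inv)) ≫
          (powAdd X n (p + m)).inv := by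
  rw [← cancel_mono ((powAdd X n (p + m)).hom ≫ pow X n ◁ (powAdd X p m).hom)]
  simp only [Category.assoc, id_tensorHom, tensorHom_id, comp_whiskerRight,
    MonoidalCategory.whiskerLeft_comp, Iso.inv_hom_id_assoc]
  rw [← powAdd_assoc, Iso.inv_hom_id_assoc, ← reassoc_of% (powAdd_assoc X n m p)]
  simp only [Iso.inv_hom_id_assoc, inv_hom_whiskerRight_assoc, whiskerLeft_inv_hom,
    Category.comp_id]
  rw [← BraidedCategory.hexagon_forward, reassoc_of% (powAdd_assoc X m n p),
    BraidedCategory.braiding_naturality_right_assoc]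

/-! ### Soundness of evaluation in a model -/

section Eval

variable {C : Type u} [Category.{v} C] [MonoidalCategory C] [SymmetricCategory C]

theorem Term.eval_eqHom {Gen : ℕ → ℕ → Type w} (X : C)
    (op : ∀ {m n : ℕ}, Gen m n → (pow X m ⟶ pow X n)) {m n : ℕ} (h : m = n) :
    Term.eval X op ((termData Gen).eqHom h) = eqToHom (congrArg (pow X) h) := by
  subst h; rfl

/-- Congruent terms have the same interpretation in every model. -/
theorem Model.eval_congr {T : Theory.{w}} (M : Model C T) {m n : ℕ}
    {s t : (termData T.Gen).Hom m n} (h : (termData T.Gen).Cong T.Eqn s t) :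
    Term.eval M.X M.op s = Term.eval M.X M.op t := by
  induction h with
  | of h => exact M.sat h
  | refl => rfl
  | symm _ ih => exact ih.symm
  | trans _ _ ih ih' => exact ih.trans ih'
  | comp_congr _ _ ih ih' => exact congrArg₂ (· ≫ ·) ih ih'
  | tensor_congr _ _ ih ih' =>
    exact congrArg (_ ≫ · ≫ _) (congrArg₂ (· ⊗ₘ ·) ih ih')
  | id_comp f => exact Category.id_comp _
  | comp_id f => exact Category.comp_id _
  | assoc f g h => exact Category.assoc _ _ _
  | tensor_id m n =>
    change _ ≫ (𝟙 _ ⊗ₘ 𝟙 _) ≫ _ = 𝟙 _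
    simp
  | tensor_comp f g f' g' =>
    change _ ≫ ((_ ≫ _) ⊗ₘ (_ ≫ _)) ≫ _ = (_ ≫ _ ≫ _) ≫ (_ ≫ _ ≫ _)
    simp
  | @tensor_assoc a b c a' b' c' f g h =>
    change (_ ≫ ((_ ≫ (Term.eval _ _ f ⊗ₘ Term.eval _ _ g) ≫ _) ⊗ₘ Term.eval _ _ h) ≫ _) ≫
      Term.eval _ _ ((termData T.Gen).eqHom _) =
      Term.eval _ _ ((termData T.Gen).eqHom _) ≫ (_ ≫ (_ ⊗ₘ (_ ≫ _ ≫ _)) ≫ _)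
    rw [Term.eval_eqHom, Term.eval_eqHom]
    exact pow_tensor_assoc M.X _ _ _
  | id_zero_tensor f =>
    change (_ ≫ (𝟙 _ ⊗ₘ Term.eval _ _ f) ≫ _) ≫ Term.eval _ _ ((termData T.Gen).eqHom _) =
      Term.eval _ _ ((termData T.Gen).eqHom _) ≫ _
    rw [Term.eval_eqHom, Term.eval_eqHom]
    exact pow_id_zero_tensor M.X _
  | tensor_id_zero f =>
    change (ρ_ _).inv ≫ (_ ⊗ₘ 𝟙 (𝟙_ C)) ≫ (ρ_ _).hom = _
    simp
  | braid_natural f g =>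
    change (_ ≫ (_ ⊗ₘ _) ≫ _) ≫ (_ ≫ _ ≫ _) = (_ ≫ _ ≫ _) ≫ (_ ≫ _ ≫ _)
    simp
  | braid_symm m n =>
    change (_ ≫ _ ≫ _) ≫ (_ ≫ _ ≫ _) = 𝟙 _
    simp
  | hexagon m n p =>
    change Term.eval _ _ ((termData T.Gen).eqHom _) ≫ (_ ≫ (β_ _ _).hom ≫ _) ≫
      Term.eval _ _ ((termData T.Gen).eqHom _) =
      (_ ≫ ((_ ≫ (β_ _ _).hom ≫ _) ⊗ₘ 𝟙 _) ≫ _) ≫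
      Term.eval _ _ ((termData T.Gen).eqHom _) ≫ (_ ≫ (𝟙 _ ⊗ₘ (_ ≫ (β_ _ _).hom ≫ _)) ≫ _)
    rw [Term.eval_eqHom, Term.eval_eqHom, Term.eval_eqHom]
    exact pow_hexagon M.X m n p

end Eval

/-! ### Morphisms of models commute with all terms -/

section PowMap

variable {C : Type u} [Category.{v} C] [MonoidalCategory C]

theorem powMap_powAdd {X Y : C} (f : X ⟶ Y) (m n : ℕ) :
    powMap f (m + n) ≫ (powAdd Y m n).hom = (powAdd X m n).hom ≫ (powMap f m ⊗ₘ powMap f n) := by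
  induction n with
  | zero =>
    change powMap f m ≫ (ρ_ _).inv = (ρ_ _).inv ≫ (powMap f m ⊗ₘ 𝟙 (𝟙_ C))
    simp
  | succ n ih =>
    change (powMap f (m + n) ⊗ₘ f) ≫ (powAdd Y m n).hom ▷ Y ≫ (α_ _ _ _).hom =
      ((powAdd X m n).hom ▷ X ≫ (α_ _ _ _).hom) ≫ (powMap f m ⊗ₘ (powMap f n ⊗ₘ f))
    rw [tensorHom_comp_whiskerRight_assoc, ih, Category.assoc, ← associator_naturality,
      ← whiskerRight_comp_tensorHom_assoc]

variable [SymmetricCategory C]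

/-- Commutation with the generators propagates through terms, the braidings and tensor products
being handled by naturality of `powAdd`. This is the naturality of the transformation induced by a
morphism of models. -/
theorem Model.eval_powMap {T : Theory.{w}} {M N : Model C T} (f : M ⟶ N) {m n : ℕ}
    (t : Term T.Gen m n) :
    t.eval M.X M.op ≫ powMap (Model.Hom.hom f) n =
      powMap (Model.Hom.hom f) m ≫ t.eval N.X N.op := by
  induction t with
  | gen σ => exact Model.Hom.comm f σ
  | id n => exact (Category.id_comp _).trans (Category.comp_id _).symm
  | braid m n =>
    change ((powAdd M.X m n).hom ≫ (β_ _ _).hom ≫ (powAdd M.X n m).inv) ≫ _ =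
      _ ≫ ((powAdd N.X m n).hom ≫ (β_ _ _).hom ≫ (powAdd N.X n m).inv)
    rw [← cancel_mono (powAdd N.X n m).hom]
    simp only [Category.assoc, powMap_powAdd, Iso.inv_hom_id_assoc, Iso.inv_hom_id,
      Category.comp_id]
    rw [reassoc_of% (powMap_powAdd (Model.Hom.hom f) m n), BraidedCategory.braiding_naturality]
  | comp s t ihs iht =>
    change (s.eval M.X M.op ≫ t.eval M.X M.op) ≫ _ = _ ≫ (s.eval N.X N.op ≫ t.eval N.X N.op)
    rw [Category.assoc, iht, reassoc_of% ihs]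
  | tensor s t ihs iht =>
    change ((powAdd M.X _ _).hom ≫ (s.eval M.X M.op ⊗ₘ t.eval M.X M.op) ≫ (powAdd M.X _ _).inv) ≫
      _ = _ ≫ ((powAdd N.X _ _).hom ≫ (s.eval N.X N.op ⊗ₘ t.eval N.X N.op) ≫ (powAdd N.X _ _).inv)
    rw [← cancel_mono (powAdd N.X _ _).hom]
    simp only [Category.assoc, powMap_powAdd, Iso.inv_hom_id_assoc, Iso.inv_hom_id,
      Category.comp_id, tensorHom_comp_tensorHom, ihs, iht]
    rw [reassoc_of% (powMap_powAdd (Model.Hom.hom f)), tensorHom_comp_tensorHom]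

end PowMap

/-! ### From models to algebras -/

section ModelToAlgebra

variable {C : Type u} [Category.{v} C] [MonoidalCategory C] [SymmetricCategory C]
  {T : Theory.{w}}

/-- The class of a term in the prop presented by a theory. -/
def Theory.ofTerm (T : Theory.{w}) {m n : ℕ} (t : Term T.Gen m n) :
    (⟨m⟩ : T.prop.Ob) ⟶ ⟨n⟩ :=
  Quot.mk _ t

/-- The functor on the presented prop determined by a model. -/
def Model.functor (M : Model C T) : T.prop.Ob ⥤ C where
  obj n := pow M.X n.val
  map f := Quot.lift (fun t => Term.eval M.X M.op t) (fun _ _ h => M.eval_congr h) f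
  map_id _ := rfl
  map_comp := by rintro _ _ _ ⟨f⟩ ⟨g⟩; rfl

theorem Model.functor_map_eqHom (M : Model C T) {m n : ℕ} (h : m = n) :
    M.functor.map (X := ⟨m⟩) (Y := ⟨n⟩) (T.prop.eqHom h) =
      eqToHom (congrArg (pow M.X) h) := by
  subst h; rfl

omit [SymmetricCategory C] in
theorem powAdd_assoc_inv (X : C) (a b c : ℕ) :
    (powAdd X a b).inv ▷ pow X c ≫ (powAdd X (a + b) c).inv ≫
      eqToHom (congrArg (pow X) (Nat.add_assoc a b c)) =
    (α_ (pow X a) (pow X b) (pow X c)).hom ≫ pow X a ◁ (powAdd X b c).inv ≫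
      (powAdd X a (b + c)).inv := by
  rw [← cancel_mono ((powAdd X a (b + c)).hom ≫ pow X a ◁ (powAdd X b c).hom)]
  simp only [Category.assoc]
  rw [← powAdd_assoc]
  simp

/-- The functor determined by a model is monoidal. -/
def Model.coreMonoidal (M : Model C T) : M.functor.CoreMonoidal where
  εIso := Iso.refl (𝟙_ C)
  μIso m n := (powAdd M.X m.val n.val).symm
  μIso_hom_natural_left := by
    rintro ⟨m⟩ ⟨n⟩ ⟨f⟩ ⟨p⟩
    change Term.eval M.X M.op f ▷ pow M.X p ≫ (powAdd M.X n p).inv = (powAdd M.X m p).inv ≫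
      (powAdd M.X m p).hom ≫ (Term.eval M.X M.op f ⊗ₘ 𝟙 _) ≫ (powAdd M.X n p).inv
    simp
  μIso_hom_natural_right := by
    rintro ⟨m⟩ ⟨n⟩ ⟨p⟩ ⟨f⟩
    change pow M.X p ◁ Term.eval M.X M.op f ≫ (powAdd M.X p n).inv = (powAdd M.X p m).inv ≫
      (powAdd M.X p m).hom ≫ (𝟙 _ ⊗ₘ Term.eval M.X M.op f) ≫ (powAdd M.X p n).inv
    simp
  associativity := by
    rintro ⟨a⟩ ⟨b⟩ ⟨c⟩
    exact (congrArg (_ ≫ _ ≫ ·) (M.functor_map_eqHom _)).trans (powAdd_assoc_inv M.X a b c)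
  left_unitality := by
    rintro ⟨n⟩
    refine Eq.trans ?_ (congrArg (_ ≫ _ ≫ ·) (M.functor_map_eqHom _).symm)
    refine Eq.trans ?_ (congrArg (_ ≫ _ ≫ ·) (powAdd_zero_left M.X n))
    have key : ∀ {A B : C} (e : A ≅ 𝟙_ C ⊗ B),
        (λ_ B).hom = 𝟙 (𝟙_ C) ▷ B ≫ e.inv ≫ e.hom ≫ (λ_ B).hom := by
      intros; simp
    exact key (powAdd M.X 0 n)
  right_unitality := by
    rintro ⟨n⟩
    change (ρ_ (pow M.X n)).hom = pow M.X n ◁ 𝟙 (𝟙_ C) ≫ (ρ_ (pow M.X n)).hom ≫ 𝟙 _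
    simp

instance (M : Model C T) : M.functor.Braided where
  toMonoidal := M.coreMonoidal.toMonoidal
  braided := by
    rintro ⟨m⟩ ⟨n⟩
    change (powAdd M.X m n).inv ≫ (powAdd M.X m n).hom ≫ (β_ _ _).hom ≫ (powAdd M.X n m).inv =
      (β_ _ _).hom ≫ (powAdd M.X n m).inv
    simp

variable (C T) in
/-- The functor sending a model to the algebra it determines. -/
def modelToAlgebra : Model C T ⥤ Algebra T.prop C where
  obj M := ⟨M.functor⟩
  map {M N} f :=
    { trans :=
        { app n := powMap (Model.Hom.hom f) n.val
          naturality := by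
            rintro ⟨m⟩ ⟨n⟩ ⟨t⟩
            exact Model.eval_powMap f t }
      isMonoidal :=
        { unit := Category.id_comp _
          tensor := by
            rintro ⟨m⟩ ⟨n⟩
            change (powAdd M.X m n).inv ≫ powMap _ (m + n) =
              (powMap _ m ⊗ₘ powMap _ n) ≫ (powAdd N.X m n).inv
            rw [Iso.inv_comp_eq, ← reassoc_of% (powMap_powAdd (Model.Hom.hom f)), Iso.hom_inv_id,
              Category.comp_id] } }
  map_id M := Algebra.Hom.ext (by ext n; exact powMap_id _ _)
  map_comp f g := Algebra.Hom.ext (by ext n; exact powMap_comp _ _ _)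

end ModelToAlgebra

/-! ### Monoidal transformations are determined at the generating object -/

section FullyFaithful

variable {C : Type u} [Category.{v} C] [MonoidalCategory C] [SymmetricCategory C]
  {T : Theory.{w}}

-- The first power is `𝟙_ C ⊗ X` rather than `X`, so passing between a morphism and its component at
-- `1` costs a left unitor.
omit [SymmetricCategory C] in
theorem powMap_one {X Y : C} (f : X ⟶ Y) :
    powMap f 1 ≫ (λ_ Y).hom = (λ_ X).hom ≫ f := by
  change (𝟙 (𝟙_ C) ⊗ₘ f) ≫ _ = _
  simp

instance : (modelToAlgebra C T).Faithful where
  map_injective {M N} f g h := by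
    have h' : powMap (Model.Hom.hom f) 1 = powMap (Model.Hom.hom g) 1 :=
      congrArg (fun k => (Algebra.Hom.trans k).app ⟨1⟩) h
    refine Model.Hom.ext ?_
    rw [← cancel_epi (λ_ M.X).hom, ← powMap_one, ← powMap_one, h']

/-- The component at `1`, stripped of unitors, is the candidate `h`. Monoidality forces the
component at `n` to be the `n`-th power of `h`, and naturality at the generators then says that `h`
is a morphism of models. -/
instance : (modelToAlgebra C T).Full where
  map_surjective {M N} θ := by
    let τ : M.functor ⟶ N.functor := Algebra.Hom.trans θ
    have hτ : NatTrans.IsMonoidal τ := Algebra.Hom.isMonoidal θ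
    let τ₁ : 𝟙_ C ⊗ M.X ⟶ 𝟙_ C ⊗ N.X := τ.app ⟨1⟩
    let h : M.X ⟶ N.X := (λ_ M.X).inv ≫ τ₁ ≫ (λ_ N.X).hom
    have h₁ : τ₁ = 𝟙_ C ◁ h := by
      rw [← cancel_mono (λ_ N.X).hom, leftUnitor_naturality]
      exact (Iso.hom_inv_id_assoc _ _).symm
    -- `α⁻¹ ≫ ρ ▷ _` is the unfolded inverse of `powAdd _ n 1`, the tensorator of a model's functor
    -- at `(n, 1)`.
    have key' : ∀ {A B : C} (p : A ⟶ B), (p ⊗ₘ τ₁) ≫ (α_ B (𝟙_ C) N.X).inv ≫ (ρ_ B).hom ▷ N.X =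
        ((α_ A (𝟙_ C) M.X).inv ≫ (ρ_ A).hom ▷ M.X) ≫ (p ⊗ₘ h) := by
      intro A B p
      rw [h₁]
      have h₂ : 𝟙_ C ◁ h ≫ (λ_ N.X).hom = (λ_ M.X).hom ≫ h := leftUnitor_naturality h
      have tri : ∀ (B Y : C), (α_ B (𝟙_ C) Y).inv ≫ (ρ_ B).hom ▷ Y = B ◁ (λ_ Y).hom := by
        intros; simp
      rw [tri, tri, tensorHom_comp_whiskerLeft,
        whiskerLeft_comp_tensorHom, h₂]
    have key : ∀ n, τ.app ⟨n⟩ = powMap h n := by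
      intro n
      induction n with
      | zero => exact (Category.id_comp _).symm.trans hτ.unit
      | succ n ih =>
        have := hτ.tensor ⟨n⟩ ⟨1⟩
        rw [ih] at this
        exact (cancel_epi (powAdd M.X n 1).inv).1 (this.trans (key' (powMap h n)))
    refine ⟨⟨h, fun σ => ?_⟩, ?_⟩
    · have := τ.naturality (T.ofTerm (.gen σ))
      rw [key, key] at this
      exact this
    · refine Algebra.Hom.ext ?_
      ext n
      exact (key n.val).symm

end FullyFaithful

/-! ### From algebras to models, and the equivalence -/

section AlgebraToModel

open Functor.LaxMonoidal Functor.OplaxMonoidal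

variable {C : Type u} [Category.{v} C] [MonoidalCategory C]

/-- The canonical isomorphism from the tensor power of the underlying object of an algebra to its
value at `n`. -/
def PROP.powIso {P : PROP.{w}} (F : P.Ob ⥤ C) [F.Monoidal] :
    ∀ n : ℕ, pow (F.obj ⟨1⟩) n ≅ F.obj ⟨n⟩
  | 0 => Functor.Monoidal.εIso F
  | n + 1 => whiskerRightIso (powIso F n) (F.obj ⟨1⟩) ≪≫ Functor.Monoidal.μIso F ⟨n⟩ ⟨1⟩

theorem PROP.powIso_succ_hom {P : PROP.{w}} (F : P.Ob ⥤ C) [F.Monoidal] (n : ℕ) :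
    (powIso F (n + 1)).hom = (powIso F n).hom ▷ F.obj ⟨1⟩ ≫ μ F ⟨n⟩ ⟨1⟩ := rfl

/-- This is the monoidality of the family `powIso`. The induction step is the associativity axiom of
the tensorator of `F`, the base case its right unit axiom. -/
theorem PROP.powAdd_powIso {P : PROP.{w}} (F : P.Ob ⥤ C) [F.Monoidal] (m n : ℕ) :
    (powIso F (m + n)).hom = (powAdd (F.obj ⟨1⟩) m n).hom ≫
      ((powIso F m).hom ⊗ₘ (powIso F n).hom) ≫ μ F ⟨m⟩ ⟨n⟩ := by
  induction n with
  | zero =>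
    have h := Functor.LaxMonoidal.right_unitality F ⟨m⟩
    have h' : F.map (ρ_ (⟨m⟩ : P.Ob)).hom = 𝟙 _ := F.map_id _
    rw [h'] at h
    replace h : (ρ_ (F.obj ⟨m⟩)).hom = F.obj ⟨m⟩ ◁ ε F ≫ μ F ⟨m⟩ (𝟙_ P.Ob) :=
      h.trans (congrArg (_ ≫ ·) (Category.comp_id _))
    change (powIso F m).hom = (ρ_ _).inv ≫ ((powIso F m).hom ⊗ₘ ε F) ≫ μ F ⟨m⟩ (𝟙_ P.Ob)
    rw [MonoidalCategory.tensorHom_def, Category.assoc, ← h]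
    simp
  | succ n ih =>
    have h := Functor.LaxMonoidal.associativity F ⟨m⟩ ⟨n⟩ ⟨1⟩
    -- `(m + n) + 1` and `m + (n + 1)` agree definitionally, so this associator of the prop is an
    -- identity.
    have h' : F.map (α_ (⟨m⟩ : P.Ob) ⟨n⟩ ⟨1⟩).hom = 𝟙 _ := F.map_id _
    rw [h'] at h
    replace h : μ F ⟨m⟩ ⟨n⟩ ▷ F.obj ⟨1⟩ ≫ μ F ⟨m + n⟩ ⟨1⟩ =
        (α_ _ _ _).hom ≫ F.obj ⟨m⟩ ◁ μ F ⟨n⟩ ⟨1⟩ ≫ μ F ⟨m⟩ ⟨n + 1⟩ :=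
      (congrArg (_ ≫ ·) (Category.comp_id _)).symm.trans h
    refine (powIso_succ_hom F (m + n)).trans ?_
    have key : ∀ {A B A' B' S Y Z V W : C} (p : S ⟶ A ⊗ B) (f : A ⟶ A') (g : B ⟶ B')
        (m₁ : A' ⊗ B' ⟶ Z) (m₂ : Z ⊗ Y ⟶ W) (m₃ : B' ⊗ Y ⟶ V) (m₄ : A' ⊗ V ⟶ W),
        m₁ ▷ Y ≫ m₂ = (α_ _ _ _).hom ≫ A' ◁ m₃ ≫ m₄ →
          (p ≫ (f ⊗ₘ g) ≫ m₁) ▷ Y ≫ m₂ =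
            (p ▷ Y ≫ (α_ _ _ _).hom) ≫ (f ⊗ₘ (g ▷ Y ≫ m₃)) ≫ m₄ := by
      intro A B A' B' S Y Z V W p f g m₁ m₂ m₃ m₄ h
      rw [comp_whiskerRight_assoc, comp_whiskerRight_assoc, h, ← tensorHom_comp_whiskerLeft]
      simp only [Category.assoc, ← tensorHom_id, associator_naturality_assoc]
    rw [ih]
    exact key _ _ _ _ _ _ _ h

variable [SymmetricCategory C] {T : Theory.{w}}

/-- True for generators by the choice of operations, and inherited by all terms since `F` is braided
monoidal. It supplies the equations of the model of `F`, the naturality of `modelIso`, and later the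
evaluation at the generating object. -/
theorem Algebra.eval_eq (F : T.prop.Ob ⥤ C) [F.Braided] {m n : ℕ} (t : Term T.Gen m n) :
    t.eval (F.obj ⟨1⟩) (fun {m n} σ => (PROP.powIso F m).hom ≫ F.map (T.ofTerm (.gen σ)) ≫
      (PROP.powIso F n).inv) =
    (PROP.powIso F m).hom ≫ F.map (T.ofTerm t) ≫ (PROP.powIso F n).inv := by
  induction t with
  | gen σ => rfl
  | id n =>
    have : F.map (T.ofTerm (.id n)) = 𝟙 _ := F.map_id _
    rw [this]
    simp [Term.eval]
  | braid m n =>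
    have h : F.map (T.ofTerm (.braid m n)) =
      F.map (β_ (⟨m⟩ : T.prop.Ob) ⟨n⟩).hom := rfl
    -- The image of a braiding under `F` is `δ ≫ β ≫ μ`; `k` and `d` stand for the mutually inverse
    -- `μ` and `δ`.
    have key : ∀ {A B A' B' S S' Z Z' : C} (p : S ≅ A ⊗ B) (p' : S' ≅ B ⊗ A) (f : A ⟶ A')
        (g : B ⟶ B') (k : A' ⊗ B' ⟶ Z) (d : Z ⟶ A' ⊗ B') (k' : B' ⊗ A' ⟶ Z'), k ≫ d = 𝟙 _ →
        (p.hom ≫ (β_ A B).hom ≫ p'.inv) ≫ p'.hom ≫ (g ⊗ₘ f) ≫ k' =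
          (p.hom ≫ (f ⊗ₘ g) ≫ k) ≫ d ≫ (β_ A' B').hom ≫ k' := by
      intro A B A' B' S S' Z Z' p p' f g k d k' h
      simp [reassoc_of% h]
    rw [h, Functor.map_braiding, ← Category.assoc (PROP.powIso F _).hom, Iso.eq_comp_inv,
      PROP.powAdd_powIso, PROP.powAdd_powIso]
    exact key _ _ _ _ _ _ _ (Functor.Monoidal.μ_δ F _ _)
  | comp s t ihs iht =>
    have h : F.map (T.ofTerm (.comp s t)) = F.map (T.ofTerm s) ≫ F.map (T.ofTerm t) :=
      F.map_comp (T.ofTerm s) (T.ofTerm t)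
    rw [h, Term.eval, ihs, iht]
    simp
  | @tensor m n p q s t ihs iht =>
    have h : F.map (T.ofTerm (.tensor s t)) = F.map (T.ofTerm s ⊗ₘ T.ofTerm t) := rfl
    have key : ∀ {A B A' B' A₁ B₁ A₁' B₁' S S' Z Z' : C} (p : S ≅ A ⊗ B) (p' : S' ≅ A₁ ⊗ B₁)
        (a : A ≅ A') (b : B ≅ B') (a₁ : A₁ ≅ A₁') (b₁ : B₁ ≅ B₁') (f : A' ⟶ A₁') (g : B' ⟶ B₁')
        (k : A' ⊗ B' ⟶ Z) (k' : A₁' ⊗ B₁' ⟶ Z') (x : Z ⟶ Z'), (f ⊗ₘ g) ≫ k' = k ≫ x →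
        (p.hom ≫ ((a.hom ≫ f ≫ a₁.inv) ⊗ₘ (b.hom ≫ g ≫ b₁.inv)) ≫ p'.inv) ≫ p'.hom ≫
          (a₁.hom ⊗ₘ b₁.hom) ≫ k' = (p.hom ≫ (a.hom ⊗ₘ b.hom) ≫ k) ≫ x := by
      intro A B A' B' A₁ B₁ A₁' B₁' S S' Z Z' p p' a b a₁ b₁ f g k k' x h
      simp [← h]
    rw [h, Term.eval, ihs, iht]
    refine ((Iso.eq_comp_inv _).2 ?_).trans (Category.assoc _ _ _)
    rw [PROP.powAdd_powIso, PROP.powAdd_powIso]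
    exact key _ _ _ _ _ _ _ _ _ _ _ (μ_natural F (T.ofTerm s) (T.ofTerm t))

/-- The model determined by an algebra. -/
def Algebra.model (A : Algebra T.prop C) : Model C T where
  X := A.functor.obj ⟨1⟩
  op {m n} σ := (PROP.powIso A.functor m).hom ≫ A.functor.map (T.ofTerm (.gen σ)) ≫
      (PROP.powIso A.functor n).inv
  sat {m n s t} h := by
    have : T.ofTerm s = T.ofTerm t := Quot.sound (.of h)
    rw [Algebra.eval_eq, Algebra.eval_eq, this]

def Algebra.modelIso (A : Algebra T.prop C) : A.model.functor ≅ A.functor :=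
  NatIso.ofComponents (fun n => PROP.powIso A.functor n.val) (by
    rintro ⟨m⟩ ⟨n⟩ ⟨t⟩
    refine (Iso.eq_comp_inv (PROP.powIso A.functor n)).1 ?_
    exact (Algebra.eval_eq A.functor t).trans (Category.assoc _ _ _).symm)

theorem Algebra.isMonoidal_modelIso (A : Algebra T.prop C) :
    NatTrans.IsMonoidal A.modelIso.hom where
  unit := Category.id_comp _
  tensor := by
    rintro ⟨m⟩ ⟨n⟩
    change (powAdd _ m n).inv ≫ (PROP.powIso A.functor (m + n)).hom =
      ((PROP.powIso A.functor m).hom ⊗ₘ (PROP.powIso A.functor n).hom) ≫ μ A.functor ⟨m⟩ ⟨n⟩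
    rw [PROP.powAdd_powIso, Iso.inv_hom_id_assoc]

def Algebra.isoMk {P : PROP.{w}} {A B : Algebra P C} (e : A.functor ≅ B.functor)
    (h : NatTrans.IsMonoidal e.hom) : A ≅ B where
  hom := ⟨e.hom⟩
  inv := ⟨e.inv⟩
  hom_inv_id := Algebra.Hom.ext e.hom_inv_id
  inv_hom_id := Algebra.Hom.ext e.inv_hom_id

/-- An algebra is recovered from its model. -/
def Algebra.modelToAlgebraIso (A : Algebra T.prop C) : (modelToAlgebra C T).obj A.model ≅ A :=
  Algebra.isoMk A.modelIso A.isMonoidal_modelIso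

instance : (modelToAlgebra C T).EssSurj where
  mem_essImage A := ⟨A.model, ⟨A.modelToAlgebraIso⟩⟩

instance : (modelToAlgebra C T).IsEquivalence where

variable (C T) in
def modelEvalOne : modelToAlgebra C T ⋙ Algebra.evalOne T.prop C ≅ Model.forget C T :=
  NatIso.ofComponents (fun M => λ_ M.X) (fun f => powMap_one (Model.Hom.hom f))

-- `powAdd` is composed of unitors and whiskered associators only, all of them identities in a
-- strict category.
omit [SymmetricCategory C] in
theorem powAdd_inv_eq_eqToHom [IsStrict C] (X : C) (m n : ℕ) :
    ∃ h : pow X m ⊗ pow X n = pow X (m + n), (powAdd X m n).inv = eqToHom h := by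
  induction n with
  | zero => exact IsStrict.rightUnitor (pow X m)
  | succ n ih =>
    obtain ⟨h, e⟩ := ih
    obtain ⟨h', e'⟩ := IsStrict.associator (pow X m) (pow X n) X
    have e'' : (α_ (pow X m) (pow X n) X).inv = eqToHom h'.symm := by
      rw [← cancel_epi (α_ (pow X m) (pow X n) X).hom, Iso.hom_inv_id, e']
      simp
    refine ⟨h'.symm.trans (congrArg (· ⊗ X) h), ?_⟩
    change (α_ (pow X m) (pow X n) X).inv ≫ (powAdd X m n).inv ▷ X = _
    rw [e, e'', eqToHom_whiskerRight, eqToHom_trans]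
    rfl

theorem isStrict_modelToAlgebra (h : IsStrict C) (M : Model C T) :
    Algebra.isStrict T.prop C ((modelToAlgebra C T).obj M) :=
  ⟨⟨rfl, rfl⟩, fun m n => powAdd_inv_eq_eqToHom M.X m.val n.val⟩

/-- The equivalence is the inverse of `modelToAlgebra`; underlying objects are compared by the left
unitor `𝟙_ C ⊗ X ≅ X` and the counit of the equivalence. -/
theorem isPropFor_prop (T : Theory.{w}) : IsPropFor.{v, u} T.prop T := by
  intro C _ _ _
  refine ⟨⟨(modelToAlgebra C T).asEquivalence.symm, ⟨?_⟩⟩, fun h => ?_⟩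
  · exact Functor.isoWhiskerLeft _ (modelEvalOne C T).symm ≪≫ (Functor.associator _ _ _).symm ≪≫
      Functor.isoWhiskerRight (modelToAlgebra C T).asEquivalence.counitIso _ ≪≫
      Functor.leftUnitor _
  -- The strict algebras form a full subcategory containing the image of `modelToAlgebra`, so full
  -- faithfulness is inherited and the isomorphism between an algebra and that of its model still
  -- gives essential surjectivity.
  · let L := (Algebra.isStrict T.prop C).lift (modelToAlgebra C T) (isStrict_modelToAlgebra h)
    have : L.EssSurj :=
      ⟨fun A => ⟨A.obj.model,
        ⟨(Algebra.isStrict T.prop C).isoMk A.obj.modelToAlgebraIso⟩⟩⟩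
    have : L.IsEquivalence := { }
    refine ⟨L.asEquivalence.symm, ⟨?_⟩⟩
    exact Functor.isoWhiskerLeft _ (modelEvalOne C T).symm ≪≫
      (Functor.associator L.inv L
        ((Algebra.isStrict T.prop C).ι ⋙ Algebra.evalOne T.prop C)).symm ≪≫
      Functor.isoWhiskerRight L.asEquivalence.counitIso _ ≪≫
      Functor.leftUnitor _

end AlgebraToModel

/-! ### Morphisms out of a presented prop -/

section Interp

/-- The interpretation of a term in a prop, given the interpretation of the generators. -/
def Term.interp {Gen : ℕ → ℕ → Type w} (Q : PROP.{w})
    (op : ∀ {m n : ℕ}, Gen m n → Q.Hom m n) : ∀ {m n : ℕ}, Term Gen m n → Q.Hom m n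
  | _, _, .gen σ => op σ
  | _, _, .id n => Q.id n
  | _, _, .braid m n => Q.braid m n
  | _, _, .comp s t => Q.comp (s.interp Q op) (t.interp Q op)
  | _, _, .tensor s t => Q.tensor (s.interp Q op) (t.interp Q op)

theorem Term.interp_eqHom {Gen : ℕ → ℕ → Type w} (Q : PROP.{w})
    (op : ∀ {m n : ℕ}, Gen m n → Q.Hom m n) {m n : ℕ} (h : m = n) :
    Term.interp Q op ((termData Gen).eqHom h) = Q.eqHom h := by
  subst h; rfl

theorem Theory.interp_congr (T : Theory.{w}) (Q : PROP.{w})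
    (op : ∀ {m n : ℕ}, T.Gen m n → Q.Hom m n)
    (sat : ∀ {m n : ℕ} {s t : Term T.Gen m n}, T.Eqn s t → s.interp Q op = t.interp Q op)
    {m n : ℕ} {s t : (termData T.Gen).Hom m n} (h : (termData T.Gen).Cong T.Eqn s t) :
    Term.interp Q op s = Term.interp Q op t := by
  induction h with
  | of h => exact sat h
  | refl => rfl
  | symm _ ih => exact ih.symm
  | trans _ _ ih ih' => exact ih.trans ih'
  | comp_congr _ _ ih ih' => exact congrArg₂ Q.comp ih ih'
  | tensor_congr _ _ ih ih' => exact congrArg₂ Q.tensor ih ih'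
  | id_comp f => exact Q.id_comp _
  | comp_id f => exact Q.comp_id _
  | assoc f g h => exact Q.assoc _ _ _
  | tensor_id m n => exact Q.tensor_id _ _
  | tensor_comp f g f' g' => exact Q.tensor_comp _ _ _ _
  | tensor_assoc f g h =>
    refine (congrArg (Q.comp _) (Term.interp_eqHom Q op _)).trans
      ((Q.tensor_assoc _ _ _).trans (congrArg (Q.comp · _) (Term.interp_eqHom Q op _).symm))
  | id_zero_tensor f =>
    refine (congrArg (Q.comp _) (Term.interp_eqHom Q op _)).trans
      ((Q.id_zero_tensor _).trans (congrArg (Q.comp · _) (Term.interp_eqHom Q op _).symm))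
  | tensor_id_zero f => exact Q.tensor_id_zero _
  | braid_natural f g => exact Q.braid_natural _ _
  | braid_symm m n => exact Q.braid_symm _ _
  | hexagon m n p =>
    change Q.comp (Term.interp Q op ((termData T.Gen).eqHom _)) (Q.comp _
      (Term.interp Q op ((termData T.Gen).eqHom _))) = Q.comp _ (Q.comp
      (Term.interp Q op ((termData T.Gen).eqHom _)) _)
    rw [Term.interp_eqHom, Term.interp_eqHom, Term.interp_eqHom]
    exact Q.hexagon m n p

/-- The morphism out of a presented prop determined by an interpretation of the generators which
satisfies the equations. -/
def Theory.desc (T : Theory.{w}) (Q : PROP.{w}) (op : ∀ {m n : ℕ}, T.Gen m n → Q.Hom m n)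
    (sat : ∀ {m n : ℕ} {s t : Term T.Gen m n}, T.Eqn s t → s.interp Q op = t.interp Q op) :
    T.prop ⟶ Q where
  map f := Quot.lift (fun t => Term.interp Q op t) (fun _ _ h => T.interp_congr Q op sat h) f
  map_id _ := rfl
  map_comp := by rintro _ _ _ ⟨f⟩ ⟨g⟩; rfl
  map_tensor := by rintro _ _ _ _ ⟨f⟩ ⟨g⟩; rfl
  map_braid _ _ := rfl

/-- A morphism of props which is bijective on morphisms is an isomorphism. -/
theorem PROP.nonempty_iso {P Q : PROP.{w}} (F : P ⟶ Q)
    (h : ∀ m n : ℕ, Function.Bijective (fun f : P.Hom m n => Morphism.map F f)) :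
    Nonempty (P ≅ Q) := by
  let e := fun m n => Equiv.ofBijective _ (h m n)
  have he : ∀ {m n : ℕ} (f : Q.Hom m n), Morphism.map F ((e m n).symm f) = f :=
    fun f => (e _ _).apply_symm_apply f
  have hinj : ∀ {m n : ℕ} {f g : P.Hom m n}, Morphism.map F f = Morphism.map F g → f = g :=
    fun h' => (h _ _).1 h'
  let G : Q ⟶ P :=
    { map := fun {m n} f => (e m n).symm f
      map_id := fun n => hinj ((he _).trans (Morphism.map_id F n).symm)
      map_comp := fun f g => hinj (by rw [Morphism.map_comp, he, he, he])
      map_tensor := fun f g => hinj (by rw [Morphism.map_tensor, he, he, he])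
      map_braid := fun m n => hinj ((he _).trans (Morphism.map_braid F m n).symm) }
  exact ⟨⟨F, G, Morphism.ext (by funext m n f; exact hinj (he _)),
    Morphism.ext (by funext m n f; exact he f)⟩⟩

end Interp

/-! ### The morphism to relations -/

namespace SBB

/-- The relations interpreting the generators. -/
def relOp : ∀ {m n : ℕ}, Gen m n → relProp.Hom m n := fun _ _ _ => True

/-- The relation denoted by a term. -/
abbrev rel {m n : ℕ} (t : Term Gen m n) : relProp.Hom m n := t.interp relProp relOp

/-- The disjoint union of two decidable relations is decidable. -/
@[reducible]
def decidableLiftRel {α β γ δ : Type} {r : α → γ → Prop} {s : β → δ → Prop}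
    (hr : ∀ a c, Decidable (r a c)) (hs : ∀ b d, Decidable (s b d)) :
    ∀ x y, Decidable (Sum.LiftRel r s x y)
  | .inl a, .inl c => decidable_of_iff (r a c) Sum.liftRel_inl_inl.symm
  | .inl _, .inr _ => .isFalse Sum.not_liftRel_inl_inr
  | .inr _, .inl _ => .isFalse Sum.not_liftRel_inr_inl
  | .inr b, .inr d => decidable_of_iff (s b d) Sum.liftRel_inr_inr.symm

/-- The relation denoted by a term is decidable. -/
@[reducible]
def decidableRel : ∀ {m n : ℕ} (t : Term Gen m n) (i : Fin m) (j : Fin n), Decidable (rel t i j)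
  | _, _, .gen _, _, _ => .isTrue trivial
  | _, _, .id _, i, j => inferInstanceAs (Decidable (i = j))
  | _, _, .braid _ _, i, j =>
    inferInstanceAs (Decidable ((finSumFinEquiv.symm i).swap = finSumFinEquiv.symm j))
  | _, _, .comp s t, i, j =>
    have := decidableRel s
    have := decidableRel t
    inferInstanceAs (Decidable (∃ k, rel s i k ∧ rel t k j))
  | _, _, .tensor s t, i, j =>
    decidableLiftRel (decidableRel s) (decidableRel t) (finSumFinEquiv.symm i)
      (finSumFinEquiv.symm j)

/-- Equivalence of the relations denoted by two terms is decidable. -/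
@[reducible]
def decidableRelIff {m n : ℕ} (s t : Term Gen m n) : Decidable (∀ i j, rel s i j ↔ rel t i j) :=
  @Nat.decidableForallFin _ _ fun i => @Nat.decidableForallFin _ _ fun j =>
    @instDecidableIff _ _ (decidableRel s i j) (decidableRel t i j)

theorem rel_eq_of_decide {m n : ℕ} {s t : Term Gen m n}
    (h : @decide _ (decidableRelIff s t) = true) : rel s = rel t :=
  RelProp.hom_ext (@of_decide_eq_true _ (decidableRelIff s t) h)

/-- Each law compares two explicit relations between sets with at most three elements, so it is
decided by computation. -/
theorem rel_sat {m n : ℕ} {s t : Term Gen m n} (h : Eqn s t) : rel s = rel t := by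
  cases h <;> exact rel_eq_of_decide rfl

/-- The morphism of props from terms to relations. -/
def toRel : sbb.prop ⟶ relProp := sbb.desc relProp relOp rel_sat

end SBB

/-! ### Every relation is denoted by a term -/

namespace SBB

theorem liftRel_flip {α β γ δ : Type} (r : α → γ → Prop) (s : β → δ → Prop) (x : γ ⊕ δ)
    (y : α ⊕ β) : Sum.LiftRel (flip r) (flip s) x y ↔ Sum.LiftRel r s y x := by
  rcases x with x | x <;> rcases y with y | y <;> simp [flip]

/-- The relation relating everything. -/
def total (m n : ℕ) : RelProp.data.Hom m n := fun _ _ => True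

/-- A relation is definable if it is denoted by a term. -/
def Definable {m n : ℕ} (R : RelProp.data.Hom m n) : Prop := ∃ t : Term Gen m n, rel t = R

theorem Definable.comp {l m n : ℕ} {R : RelProp.data.Hom l m} {S : RelProp.data.Hom m n}
    (hR : Definable R) (hS : Definable S) : Definable (RelProp.data.comp R S) := by
  obtain ⟨s, rfl⟩ := hR
  obtain ⟨t, rfl⟩ := hS
  exact ⟨.comp s t, rfl⟩

theorem Definable.tensor {m n p q : ℕ} {R : RelProp.data.Hom m n} {S : RelProp.data.Hom p q}
    (hR : Definable R) (hS : Definable S) : Definable (RelProp.data.tensor R S) := by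
  obtain ⟨s, rfl⟩ := hR
  obtain ⟨t, rfl⟩ := hS
  exact ⟨.tensor s t, rfl⟩

theorem definable_id (n : ℕ) : Definable (RelProp.data.id n) := ⟨.id n, rfl⟩

theorem definable_braid (m n : ℕ) : Definable (RelProp.data.braid m n) := ⟨.braid m n, rfl⟩

theorem definable_eqHom {m n : ℕ} (h : m = n) : Definable (RelProp.data.eqHom h) := by
  subst h; exact definable_id m

theorem definable_gen {m n : ℕ} (σ : Gen m n) :
    Definable (total m n) := ⟨.gen σ, rfl⟩

/-- The signature is self-dual: converse exchanges `mul` with `comul` and `unit` with `counit`.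
Results on relations with varying target thereby also apply to varying source. -/
theorem Definable.flip {m n : ℕ} {R : RelProp.data.Hom m n} (hR : Definable R) :
    Definable (flip R : RelProp.data.Hom n m) := by
  obtain ⟨t, rfl⟩ := hR
  induction t with
  -- The converse of a total relation is total, hence denoted by the generator of the opposite type.
  | gen σ => cases σ <;> exact definable_gen (by constructor)
  | id n => exact ⟨.id n, RelProp.hom_ext fun i j => eq_comm⟩
  | braid m n =>
    refine ⟨.braid n m, RelProp.hom_ext fun i j => ?_⟩
    change (finSumFinEquiv.symm i).swap = finSumFinEquiv.symm j ↔
      (finSumFinEquiv.symm j).swap = finSumFinEquiv.symm i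
    constructor <;> intro h <;> rw [← h, Sum.swap_swap]
  | comp s t ihs iht =>
    obtain ⟨s', hs⟩ := ihs
    obtain ⟨t', ht⟩ := iht
    refine ⟨.comp t' s', ?_⟩
    change RelProp.data.comp (rel t') (rel s') = _
    rw [hs, ht]
    exact RelProp.hom_ext fun i j => exists_congr fun k => and_comm
  | tensor s t ihs iht =>
    obtain ⟨s', hs⟩ := ihs
    obtain ⟨t', ht⟩ := iht
    refine ⟨.tensor s' t', ?_⟩
    change RelProp.data.tensor (rel s') (rel t') = _
    rw [hs, ht]
    refine RelProp.hom_ext fun i j => ?_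
    change Sum.LiftRel _ _ (finSumFinEquiv.symm i) (finSumFinEquiv.symm j) ↔
      Sum.LiftRel _ _ (finSumFinEquiv.symm j) (finSumFinEquiv.symm i)
    exact liftRel_flip _ _ _ _

/-- With the summands described by values, statements about blocks of points become linear
arithmetic. -/
theorem tensor_iff_val {m n p q : ℕ} (R : RelProp.data.Hom m n) (S : RelProp.data.Hom p q)
    (i : Fin (m + p)) (j : Fin (n + q)) : RelProp.data.tensor R S i j ↔
      (∃ (a : Fin m) (b : Fin n), i.val = a.val ∧ j.val = b.val ∧ R a b) ∨
      (∃ (a : Fin p) (b : Fin q), i.val = m + a.val ∧ j.val = n + b.val ∧ S a b) := by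
  induction i using Fin.addCases with
  | left i =>
    induction j using Fin.addCases with
    | left j =>
      rw [RelProp.tensor_ll]
      constructor
      · exact fun h => .inl ⟨i, j, rfl, rfl, h⟩
      · rintro (⟨a, b, ha, hb, h⟩ | ⟨a, b, ha, hb, h⟩)
        · rwa [Fin.ext (a := i) (b := a) ha, Fin.ext (a := j) (b := b) hb]
        · have := i.isLt; simp at ha; omega
    | right j =>
      rw [RelProp.tensor_lr, false_iff]
      rintro (⟨a, b, ha, hb, h⟩ | ⟨a, b, ha, hb, h⟩)
      · have := b.isLt; simp at hb; omega
      · have := i.isLt; simp at ha; omega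
  | right i =>
    induction j using Fin.addCases with
    | left j =>
      rw [RelProp.tensor_rl, false_iff]
      rintro (⟨a, b, ha, hb, h⟩ | ⟨a, b, ha, hb, h⟩)
      · have := a.isLt; simp at ha; omega
      · have := j.isLt; simp at hb; omega
    | right j =>
      rw [RelProp.tensor_rr]
      constructor
      · exact fun h => .inr ⟨i, j, rfl, rfl, h⟩
      · rintro (⟨a, b, ha, hb, h⟩ | ⟨a, b, ha, hb, h⟩)
        · have := a.isLt; simp at ha; omega
        · rwa [Fin.ext (a := i) (b := a) (by simp at ha; omega),
            Fin.ext (a := j) (b := b) (by simp at hb; omega)]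

theorem braid_iff_val (m n : ℕ) (i : Fin (m + n)) (j : Fin (n + m)) :
    RelProp.data.braid m n i j ↔
      (i.val < m ∧ j.val = n + i.val) ∨ (m ≤ i.val ∧ j.val + m = i.val) := by
  change (finSumFinEquiv.symm i).swap = finSumFinEquiv.symm j ↔ _
  rw [← Equiv.apply_eq_iff_eq finSumFinEquiv, Equiv.apply_symm_apply]
  induction i using Fin.addCases with
  | left i => simp [Fin.ext_iff]; omega
  | right i => simp [Fin.ext_iff]; omega

/-- The relation duplicating `m` points. -/
def dup (m : ℕ) : RelProp.data.Hom m (m + m) :=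
  fun i j => j.val = i.val ∨ j.val = m + i.val

theorem dup_iff (m : ℕ) (i : Fin m) (j : Fin (m + m)) :
    dup m i j ↔ j.val = i.val ∨ j.val = m + i.val := Iff.rfl

/-- Duplicating the first `m` points and the last one separately yields blocks of sizes `m, m, 1,
1`; exchanging the two middle blocks gives the two copies of `m + 1` points. -/
theorem definable_dup (m : ℕ) : Definable (dup m) := by
  induction m with
  | zero => exact ⟨.id 0, RelProp.hom_ext fun i => i.elim0⟩
  | succ m ih =>
    let Z₀ : RelProp.data.Hom (m + (m + 1)) (m + (1 + m)) :=
      RelProp.data.tensor (RelProp.data.id m) (RelProp.data.braid m 1)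
    let Z : RelProp.data.Hom (m + m + 1) (m + 1 + m) :=
      RelProp.data.comp Z₀ (RelProp.data.eqHom (Nat.add_assoc m 1 m).symm)
    have hZ : Definable Z :=
      Definable.comp (R := Z₀) ((definable_id m).tensor (definable_braid m 1)) (definable_eqHom _)
    have hZ' : ∀ i j, Z i j ↔ (i.val < m ∧ j.val = i.val) ∨
        (m ≤ i.val ∧ i.val < m + m ∧ j.val = i.val + 1) ∨ (i.val = m + m ∧ j.val = m) := by
      intro i j
      refine (RelProp.comp_eqHom _ Z₀ i j).trans ((tensor_iff_val _ _ _ _).trans ?_)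
      constructor
      · rintro (⟨a, b, ha, hb, h⟩ | ⟨a, b, ha, hb, h⟩)
        · have h : a = b := h
          simp at hb; have := a.isLt; subst h; omega
        · rw [braid_iff_val] at h
          simp at hb; have := a.isLt; omega
      · have hi := i.isLt
        rintro (⟨h, h'⟩ | ⟨h, h'', h'⟩ | ⟨h, h'⟩)
        · exact .inl ⟨⟨i, h⟩, ⟨i, h⟩, rfl, h', rfl⟩
        · refine .inr ⟨⟨i - m, by omega⟩, ⟨i - m + 1, by omega⟩, by simp; omega, by simp; omega, ?_⟩
          rw [braid_iff_val]; simp; omega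
        · refine .inr ⟨⟨i - m, by omega⟩, ⟨0, by omega⟩, by simp; omega, by simp; omega, ?_⟩
          rw [braid_iff_val]; simp; omega
    let W : RelProp.data.Hom (m + m + 1 + 1) (m + 1 + m + 1) :=
      RelProp.data.tensor (m := m + m + 1) Z (RelProp.data.id 1)
    have hW : Definable W := Definable.tensor (R := Z) hZ (definable_id 1)
    have key : RelProp.data.comp (RelProp.data.tensor (dup m) (total 1 2)) W = dup (m + 1) := by
      refine RelProp.hom_ext fun i j => ?_
      have hj := j.isLt
      have hi := i.isLt
      rw [dup_iff]
      constructor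
      · rintro ⟨k, h, h'⟩
        replace h := (tensor_iff_val _ _ _ _).1 h
        replace h' := (tensor_iff_val (m := m + m + 1) (n := m + 1 + m) _ _ _ _).1 h'
        simp only [hZ', dup_iff] at h h'
        rcases h with ⟨a, b, ha, hb, h⟩ | ⟨a, b, ha, hb, -⟩ <;>
        rcases h' with ⟨a', b', ha', hb', h'⟩ | ⟨a', b', ha', hb', -⟩
        all_goals
          have := a.isLt
          have := b.isLt
          have := a'.isLt
          have := b'.isLt
          omega
      · intro h
        have hW' : ∀ k, W k j ↔ _ :=
          fun k => tensor_iff_val (m := m + m + 1) (n := m + 1 + m) Z (RelProp.data.id 1) k j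
        have hD : ∀ k, RelProp.data.tensor (dup m) (total 1 2) i k ↔ _ :=
          fun k => tensor_iff_val (dup m) (total 1 2) i k
        simp only [hZ'] at hW'
        simp only [dup_iff] at hD
        by_cases him : i.val < m
        · obtain ⟨k, hk⟩ : ∃ k : ℕ, j.val = i.val ∧ k = i.val ∨
              j.val = m + 1 + i.val ∧ k = m + i.val :=
            h.elim (fun h => ⟨_, .inl ⟨h, rfl⟩⟩) fun h => ⟨_, .inr ⟨h, rfl⟩⟩
          exact ⟨⟨k, by omega⟩,
            (hD _).2 (.inl ⟨⟨i, him⟩, ⟨k, by omega⟩, rfl, rfl, by simp only; omega⟩),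
            (hW' _).2 (.inl ⟨⟨k, by omega⟩, ⟨j, by omega⟩, rfl, rfl, by simp only; omega⟩)⟩
        -- Here `i` is the last point `m`, whose two copies sit at positions `2m` and `2m + 1`
        -- before the exchange.
        · refine ⟨⟨if j.val = i.val then m + m else m + m + 1, by split <;> omega⟩,
            (hD _).2 (.inr ⟨0, if j.val = i.val then 0 else 1, by simp; omega, by split <;> simp,
              trivial⟩), (hW' _).2 ?_⟩
          by_cases hji : j.val = i.val
          · refine .inl ⟨⟨m + m, by omega⟩, ⟨j, by omega⟩, by simp [hji], rfl,
              .inr (.inr ⟨rfl, by simp only; omega⟩)⟩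
          · exact .inr ⟨0, 0, by simp [hji], by simp; omega, rfl⟩
    rw [← key]
    exact (ih.tensor (definable_gen .comul)).comp hW

theorem definable_zero (m : ℕ) (R : RelProp.data.Hom m 0) : Definable R := by
  induction m with
  | zero => exact ⟨.id 0, RelProp.hom_ext fun i => i.elim0⟩
  | succ m ih =>
    -- Only a term `m → 0` is needed, as all relations into the empty set coincide.
    obtain ⟨t, -⟩ := ih fun _ _ => True
    exact ⟨.tensor t counit, RelProp.hom_ext fun _ j => j.elim0⟩

/-- Disjoint union is a product in the category of relations, with `dup m` as diagonal; this
computes the pairing of `R` and `S`. -/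
theorem comp_dup_tensor {m n p : ℕ} (R : RelProp.data.Hom m n) (S : RelProp.data.Hom m p)
    (i : Fin m) (j : Fin (n + p)) : RelProp.data.comp (dup m) (RelProp.data.tensor R S) i j ↔
      Fin.addCases (motive := fun _ => Prop) (fun a => R i a) (fun b => S i b) j := by
  have h₁ : ∀ k, dup m i (Fin.castAdd m k) ↔ i = k := fun k => by
    have := k.isLt
    simp [dup, Fin.ext_iff]; omega
  have h₂ : ∀ k, dup m i (Fin.natAdd m k) ↔ i = k := fun k => by
    have := i.isLt
    simp [dup, Fin.ext_iff]; omega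
  change (∃ k, dup m i k ∧ _) ↔ _
  have hk : ∀ p : Fin (m + m) → Prop, (∃ k, p k) ↔
      (∃ k, p (Fin.castAdd m k)) ∨ ∃ k, p (Fin.natAdd m k) := fun p =>
    ⟨fun ⟨k, h⟩ => by
      induction k using Fin.addCases with
      | left k => exact .inl ⟨k, h⟩
      | right k => exact .inr ⟨k, h⟩, fun h => h.elim (fun ⟨k, h⟩ => ⟨_, h⟩) fun ⟨k, h⟩ => ⟨_, h⟩⟩
  rw [hk]
  induction j using Fin.addCases with
  | left j =>
    simp only [h₁, h₂, RelProp.tensor_ll, RelProp.tensor_rl, exists_eq_left', Fin.addCases_left,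
      and_false, exists_false, or_false]
  | right j =>
    simp only [h₁, h₂, RelProp.tensor_lr, RelProp.tensor_rr, exists_eq_left', Fin.addCases_right,
      and_false, exists_false, false_or]

/-- A relation into `n + 1` is the pairing of its restrictions to the first `n` points and to the
last point of the target. -/
theorem definable_of_one {m : ℕ} (h : ∀ R : RelProp.data.Hom m 1, Definable R) {n : ℕ}
    (R : RelProp.data.Hom m n) : Definable R := by
  induction n with
  | zero => exact definable_zero m R
  | succ n ih =>
    have key : RelProp.data.comp (dup m) (RelProp.data.tensor (fun i j => R i (Fin.castAdd 1 j))
        (fun i j => R i (Fin.natAdd n j))) = R := by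
      refine RelProp.hom_ext fun i j => (comp_dup_tensor _ _ i j).trans ?_
      induction j using Fin.addCases with
      | left j => simp
      | right j => simp
    rw [← key]
    exact (definable_dup m).comp ((ih _).tensor (h _))

theorem definable (m n : ℕ) (R : RelProp.data.Hom m n) : Definable R := by
  have h₁ : ∀ S : RelProp.data.Hom 1 1, Definable S := by
    intro S
    by_cases h : S 0 0
    · refine ⟨one, RelProp.hom_ext fun i j => ?_⟩
      rw [Subsingleton.elim i 0, Subsingleton.elim j 0]
      exact iff_of_true rfl h
    · refine ⟨.comp counit unit, RelProp.hom_ext fun i j => ?_⟩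
      rw [Subsingleton.elim i 0, Subsingleton.elim j 0]
      exact iff_of_false (fun ⟨k, _⟩ => k.elim0) h
  -- The target shrinks to `1`, then the converse exchanges source and target, and the target
  -- shrinks to `1` again.
  exact definable_of_one (fun S => (definable_of_one h₁ (flip S)).flip) R

end SBB

/-! ### Tensor products of comonoids behave like products -/

section Comonoids

open ComonObj MonObj

variable {C : Type u} [Category.{v} C] [MonoidalCategory C]

attribute [local instance] ComonObj.instTensorUnit

theorem isComonHom_counit (A : C) [ComonObj A] : IsComonHom ε[A] where
  hom_comul := by
    change ε[A] ≫ (λ_ (𝟙_ C)).inv = Δ[A] ≫ (ε[A] ⊗ₘ ε[A])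
    simp [unitors_inv_equal]

variable [SymmetricCategory C]

theorem isComonHom_tensorHom {A B A' B' : C} [ComonObj A] [ComonObj B] [ComonObj A'] [ComonObj B']
    (f : A ⟶ A') (g : B ⟶ B') [IsComonHom f] [IsComonHom g] : IsComonHom (f ⊗ₘ g) where
  hom_counit := by
    rw [Comon.tensorObj_counit, Comon.tensorObj_counit, tensorHom_comp_tensorHom_assoc,
      IsComonHom.hom_counit, IsComonHom.hom_counit]
  hom_comul := by
    rw [Comon.tensorObj_comul, Comon.tensorObj_comul, tensorHom_comp_tensorHom_assoc,
      IsComonHom.hom_comul, IsComonHom.hom_comul, ← tensorHom_comp_tensorHom_assoc,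
      tensorμ_natural, Category.assoc]

theorem isComonHom_associator (A B D : C) [ComonObj A] [ComonObj B] [ComonObj D] :
    IsComonHom (α_ A B D).hom where
  hom_counit := by
    simp only [Comon.tensorObj_counit]
    rw [← tensorHom_comp_whiskerLeft, Category.assoc, ← associator_naturality_assoc,
      ← tensorHom_comp_whiskerRight, Category.assoc]
    congr 1
    monoidal
  hom_comul := by
    simp only [Comon.tensorObj_comul]
    rw [← tensorHom_comp_whiskerLeft, Category.assoc, ← associator_naturality_assoc,
      ← tensorHom_comp_whiskerRight, Category.assoc, Category.assoc, tensor_associativity]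

theorem isComonHom_leftUnitor (A : C) [ComonObj A] : IsComonHom (λ_ A).hom where
  hom_counit := by
    rw [Comon.tensorObj_counit]
    change _ = (𝟙 (𝟙_ C) ⊗ₘ _) ≫ _
    simp
  hom_comul := by
    rw [Comon.tensorObj_comul, Category.assoc]
    change _ = ((λ_ (𝟙_ C)).inv ⊗ₘ _) ≫ _
    rw [MonoidalCategory.tensorHom_def', Category.assoc, ← tensor_left_unitality,
      leftUnitor_naturality]

theorem isComonHom_rightUnitor (A : C) [ComonObj A] : IsComonHom (ρ_ A).hom where
  hom_counit := by
    rw [Comon.tensorObj_counit]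
    change _ = (_ ⊗ₘ 𝟙 (𝟙_ C)) ≫ _
    rw [tensorHom_id, unitors_equal, rightUnitor_naturality]
  hom_comul := by
    rw [Comon.tensorObj_comul, Category.assoc]
    change _ = (_ ⊗ₘ (λ_ (𝟙_ C)).inv) ≫ _
    rw [MonoidalCategory.tensorHom_def, Category.assoc, ← tensor_right_unitality,
      rightUnitor_naturality]

/-- Both sides realise the same permutation of four factors. Symmetry is what allows the crossing of
`Y₂` with `X₁` to be cancelled. -/
theorem braiding_tensorμ (X₁ X₂ Y₁ Y₂ : C) :
    (β_ (X₁ ⊗ X₂) (Y₁ ⊗ Y₂)).hom ≫ tensorμ Y₁ Y₂ X₁ X₂ =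
      tensorμ X₁ X₂ Y₁ Y₂ ≫ ((β_ X₁ Y₁).hom ⊗ₘ (β_ X₂ Y₂).hom) := by
  simp [tensorμ, SymmetricCategory.braiding_swap_eq_inv_braiding Y₂ X₁,
    MonoidalCategory.tensorHom_def]

theorem isComonHom_braiding (A B : C) [ComonObj A] [ComonObj B] : IsComonHom (β_ A B).hom where
  hom_counit := by
    rw [Comon.tensorObj_counit, Comon.tensorObj_counit,
      ← BraidedCategory.braiding_naturality_assoc, braiding_leftUnitor, unitors_equal]
  hom_comul := by
    rw [Comon.tensorObj_comul, Comon.tensorObj_comul, Category.assoc, ← braiding_tensorμ,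
      BraidedCategory.braiding_naturality_assoc]

/-- Compatibility with comultiplication is dual to `(ab)(cd) = (ac)(bd)` in a commutative monoid and
is read off in the opposite category. -/
theorem isComonHom_comul (A : C) [ComonObj A] [IsCommComonObj A] : IsComonHom Δ[A] where
  hom_counit := by
    rw [Comon.tensorObj_counit]
    simp [unitors_equal]
  hom_comul := by
    let : MonObj (Opposite.op A) := Comon.ComonToMonOpOpObjMon (Comon.mk A)
    have : IsCommMonObj (Opposite.op A) :=
      ⟨Quiver.Hom.unop_inj (IsCommComonObj.comul_comm A)⟩
    have h := congrArg Quiver.Hom.unop (MonObj.mul_mul_mul_comm (Opposite.op A))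
    rw [Comon.tensorObj_comul', ← Category.assoc]
    exact h

/-- The first projection from a tensor product with a comonoid. -/
def projFst (A B : C) [ComonObj B] : A ⊗ B ⟶ A := A ◁ ε[B] ≫ (ρ_ A).hom

/-- The second projection from a tensor product with a comonoid. -/
def projSnd (A B : C) [ComonObj A] : A ⊗ B ⟶ B := ε[A] ▷ B ≫ (λ_ B).hom

theorem isComonHom_projFst (A B : C) [ComonObj A] [ComonObj B] : IsComonHom (projFst A B) := by
  have := isComonHom_counit B
  have := isComonHom_tensorHom (𝟙 A) ε[B]
  have := isComonHom_rightUnitor A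
  rw [projFst, ← id_tensorHom]
  infer_instance

theorem isComonHom_projSnd (A B : C) [ComonObj A] [ComonObj B] : IsComonHom (projSnd A B) := by
  have := isComonHom_counit A
  have := isComonHom_tensorHom ε[A] (𝟙 B)
  have := isComonHom_leftUnitor B
  rw [projSnd, ← tensorHom_id]
  infer_instance

omit [SymmetricCategory C] in
theorem tensorHom_projFst {A A' B B' : C} [ComonObj B] [ComonObj B'] (f : A ⟶ A') (g : B ⟶ B')
    [IsComonHom g] : (f ⊗ₘ g) ≫ projFst A' B' = projFst A B ≫ f := by
  rw [projFst, projFst, tensorHom_comp_whiskerLeft_assoc, IsComonHom.hom_counit]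
  simp [MonoidalCategory.tensorHom_def']

omit [SymmetricCategory C] in
theorem tensorHom_projSnd {A A' B B' : C} [ComonObj A] [ComonObj A'] (f : A ⟶ A') (g : B ⟶ B')
    [IsComonHom f] : (f ⊗ₘ g) ≫ projSnd A' B' = projSnd A B ≫ g := by
  rw [projSnd, projSnd, tensorHom_comp_whiskerRight_assoc, IsComonHom.hom_counit]
  simp [MonoidalCategory.tensorHom_def]

theorem braiding_projFst (A B : C) [ComonObj A] :
    (β_ A B).hom ≫ projFst B A = projSnd A B := by
  rw [projFst, projSnd, ← BraidedCategory.braiding_naturality_left_assoc, braiding_rightUnitor]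

theorem braiding_projSnd (A B : C) [ComonObj B] :
    (β_ A B).hom ≫ projSnd B A = projFst A B := by
  rw [projFst, projSnd, ← BraidedCategory.braiding_naturality_right_assoc, braiding_leftUnitor]

theorem tensorμ_unitors (A B : C) :
    tensorμ A (𝟙_ C) (𝟙_ C) B ≫ ((ρ_ A).hom ⊗ₘ (λ_ B).hom) = (ρ_ A).hom ⊗ₘ (λ_ B).hom := by
  have : (β_ (𝟙_ C) (𝟙_ C)).hom = 𝟙 _ := by
    rw [braiding_tensorUnit_left, unitors_equal, Iso.hom_inv_id]
  rw [tensorμ, this]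
  monoidal

/-- The projections discard one copy of `A` and one of `B`, so the two counit laws apply after
sliding the counits through the middle exchange. -/
theorem comul_projFst_projSnd (A B : C) [ComonObj A] [ComonObj B] :
    Δ[A ⊗ B] ≫ (projFst A B ⊗ₘ projSnd A B) = 𝟙 (A ⊗ B) := by
  rw [Comon.tensorObj_comul, projFst, projSnd, ← tensorHom_comp_tensorHom, ← id_tensorHom,
    ← tensorHom_id, Category.assoc, ← tensorμ_natural_assoc, tensorHom_comp_tensorHom_assoc,
    id_tensorHom, tensorHom_id, comul_counit, counit_comul, tensorμ_unitors,
    tensorHom_comp_tensorHom, Iso.inv_hom_id, Iso.inv_hom_id, id_tensorHom_id]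

/-- This is the uniqueness half of the universal property of a product; it requires no
cocommutativity. -/
theorem eq_comul_proj {D A B : C} [ComonObj D] [ComonObj A] [ComonObj B] (h : D ⟶ A ⊗ B)
    [IsComonHom h] : h = Δ[D] ≫ (h ≫ projFst A B ⊗ₘ h ≫ projSnd A B) := by
  rw [← tensorHom_comp_tensorHom, ← IsComonHom.hom_comul_assoc, comul_projFst_projSnd,
    Category.comp_id]

end Comonoids

/-! ### Products of idempotents over unions -/

section Idempotent

theorem prod_mul_self_of_idem {M ι : Type*} [CommMonoid M] (f : ι → M) (hf : ∀ i, f i * f i = f i)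
    (S : Finset ι) : (∏ i ∈ S, f i) * ∏ i ∈ S, f i = ∏ i ∈ S, f i := by
  rw [← Finset.prod_mul_distrib]
  exact Finset.prod_congr rfl fun i _ => hf i

/-- The factors over the intersection occur twice on the right, and idempotence absorbs the
repetition. -/
theorem prod_union_of_idem {M ι : Type*} [CommMonoid M] [DecidableEq ι] (f : ι → M)
    (hf : ∀ i, f i * f i = f i) (S T : Finset ι) :
    ∏ i ∈ S ∪ T, f i = (∏ i ∈ S, f i) * ∏ i ∈ T, f i := by
  have h := Finset.prod_sdiff (f := f) (Finset.inter_subset_union (s := S) (t := T))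
  rw [← Finset.prod_union_inter, ← h, mul_assoc, prod_mul_self_of_idem f hf]

theorem prod_biUnion_of_idem {M ι κ : Type*} [CommMonoid M] [DecidableEq ι]
    (f : ι → M) (hf : ∀ i, f i * f i = f i) (S : Finset κ) (g : κ → Finset ι) :
    ∏ i ∈ S.biUnion g, f i = ∏ j ∈ S, ∏ i ∈ g j, f i := by
  classical
  induction S using Finset.induction_on with
  | empty => simp
  | insert j S hj ih =>
    rw [Finset.biUnion_insert, prod_union_of_idem f hf, ih, Finset.prod_insert hj]

end Idempotent

/-! ### Tensor powers of a comonoid and their projections -/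

section PowComonoid

open ComonObj MonObj

variable {C : Type u} [Category.{v} C] [MonoidalCategory C] [SymmetricCategory C]

attribute [local instance] ComonObj.instTensorUnit

/-- The comonoid structure on a tensor power of a comonoid. -/
instance powComon (X : C) [ComonObj X] : ∀ n : ℕ, ComonObj (pow X n)
  | 0 => ComonObj.instTensorUnit C
  | n + 1 =>
    have := powComon X n
    inferInstanceAs (ComonObj (pow X n ⊗ X))

instance powCommComon (X : C) [ComonObj X] [IsCommComonObj X] :
    ∀ n : ℕ, IsCommComonObj (pow X n)
  | 0 => inferInstanceAs (IsCommComonObj (𝟙_ C))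
  | n + 1 =>
    have := powCommComon X n
    inferInstanceAs (IsCommComonObj (pow X n ⊗ X))

theorem isComonHom_powAdd (X : C) [ComonObj X] (m n : ℕ) : IsComonHom (powAdd X m n).hom := by
  induction n with
  | zero =>
    have := isComonHom_rightUnitor (pow X m)
    exact inferInstanceAs (IsComonHom (ρ_ (pow X m)).inv)
  | succ n ih =>
    have := isComonHom_associator (pow X m) (pow X n) X
    have := isComonHom_tensorHom (powAdd X m n).hom (𝟙 X)
    rw [tensorHom_id] at this
    exact inferInstanceAs (IsComonHom ((powAdd X m n).hom ▷ X ≫ (α_ (pow X m) (pow X n) X).hom))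

/-- The projections from a tensor power of a comonoid. -/
def powProj (X : C) [ComonObj X] : ∀ n : ℕ, Fin n → (pow X n ⟶ X)
  | 0 => Fin.elim0
  | n + 1 => Fin.lastCases (motive := fun _ => pow X (n + 1) ⟶ X) (projSnd (pow X n) X)
      fun i => projFst (pow X n) X ≫ powProj X n i

theorem powProj_last (X : C) [ComonObj X] (n : ℕ) :
    powProj X (n + 1) (Fin.last n) = projSnd (pow X n) X :=
  Fin.lastCases_last

theorem powProj_castSucc (X : C) [ComonObj X] (n : ℕ) (i : Fin n) :
    powProj X (n + 1) i.castSucc = projFst (pow X n) X ≫ powProj X n i :=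
  Fin.lastCases_castSucc _

theorem isComonHom_powProj (X : C) [ComonObj X] (n : ℕ) (i : Fin n) :
    IsComonHom (powProj X n i) := by
  induction n with
  | zero => exact i.elim0
  | succ n ih =>
    induction i using Fin.lastCases with
    | last => rw [powProj_last]; exact isComonHom_projSnd (pow X n) X
    | cast i =>
      have := ih i
      have := isComonHom_projFst (pow X n) X
      rw [powProj_castSucc]
      exact inferInstanceAs (IsComonHom (projFst (pow X n) X ≫ powProj X n i))

/-- A comonoid morphism into a tensor power is determined by its components. -/
theorem powProj_ext {A X : C} [ComonObj A] [ComonObj X] {n : ℕ} {f g : A ⟶ pow X n}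
    (hf : IsComonHom f) (hg : IsComonHom g) (h : ∀ i, f ≫ powProj X n i = g ≫ powProj X n i) :
    f = g := by
  induction n with
  | zero =>
    -- The counit of the unit object is the identity, so a comonoid morphism into it equals the
    -- counit of its source.
    exact ((Category.comp_id f).symm.trans hf.hom_counit).trans
      ((Category.comp_id g).symm.trans hg.hom_counit).symm
  | succ n ih =>
    have key : ∀ {f g : A ⟶ pow X n ⊗ X} (_ : IsComonHom f) (_ : IsComonHom g),
        f ≫ projFst (pow X n) X = g ≫ projFst (pow X n) X →
        f ≫ projSnd (pow X n) X = g ≫ projSnd (pow X n) X → f = g := by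
      intro f g _ _ h₁ h₂
      rw [eq_comul_proj f, eq_comul_proj g, h₁, h₂]
    have := isComonHom_projFst (pow X n) X
    have hcomp : ∀ {f : A ⟶ pow X n ⊗ X} (_ : IsComonHom f), IsComonHom (f ≫ projFst (pow X n) X) :=
      fun _ => inferInstance
    refine key hf hg (ih (hcomp hf) (hcomp hg) fun i => ?_) ?_
    · have := h i.castSucc
      rw [powProj_castSucc] at this
      exact (Category.assoc _ _ _).trans (this.trans (Category.assoc _ _ _).symm)
    · have := h (Fin.last n)
      rwa [powProj_last] at this

theorem associator_projFst (A B D : C) [ComonObj B] [ComonObj D] :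
    (α_ A B D).hom ≫ projFst A (B ⊗ D) = projFst (A ⊗ B) D ≫ projFst A B := by
  rw [projFst, projFst, projFst, Comon.tensorObj_counit, MonoidalCategory.tensorHom_def']
  simp

omit [SymmetricCategory C] in
theorem associator_projSnd (A B D : C) [ComonObj A] :
    (α_ A B D).hom ≫ projSnd A (B ⊗ D) = projSnd A B ▷ D := by
  rw [projSnd, projSnd]
  simp

omit [SymmetricCategory C] in
theorem whiskerRight_projFst {A B : C} (f : A ⟶ B) (D : C) [ComonObj D] :
    f ▷ D ≫ projFst B D = projFst A D ≫ f := by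
  rw [← tensorHom_id, tensorHom_projFst]

omit [SymmetricCategory C] in
theorem whiskerRight_projSnd {A B : C} [ComonObj A] [ComonObj B] (f : A ⟶ B) (hf : IsComonHom f)
    (D : C) : f ▷ D ≫ projSnd B D = projSnd A D := by
  rw [← tensorHom_id, tensorHom_projSnd, Category.comp_id]

/-- Splitting a power matches splitting its index set; with its companion for `natAdd`, this relates
tensor products of terms to disjoint unions componentwise. -/
theorem powAdd_projFst_powProj (X : C) [ComonObj X] (m n : ℕ) (i : Fin m) :
    (powAdd X m n).hom ≫ projFst (pow X m) (pow X n) ≫ powProj X m i =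
      powProj X (m + n) (Fin.castAdd n i) := by
  induction n with
  | zero =>
    have key : ∀ A : C, (ρ_ A).inv ≫ projFst A (𝟙_ C) = 𝟙 A := by
      intro A
      rw [projFst]
      change _ ≫ A ◁ 𝟙 (𝟙_ C) ≫ _ = _
      simp
    exact (Category.assoc _ _ _).symm.trans ((congrArg (· ≫ powProj X m i) (key (pow X m))).trans
      (Category.id_comp _))
  | succ n ih =>
    refine Eq.trans ?_ (powProj_castSucc X (m + n) (Fin.castAdd n i)).symm
    rw [← ih]
    change ((powAdd X m n).hom ▷ X ≫ (α_ (pow X m) (pow X n) X).hom) ≫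
      projFst (pow X m) (pow X n ⊗ X) ≫ _ = _
    rw [Category.assoc, reassoc_of% (associator_projFst (pow X m) (pow X n) X),
      reassoc_of% (whiskerRight_projFst (powAdd X m n).hom X)]

theorem powAdd_projSnd_powProj (X : C) [ComonObj X] (m n : ℕ) (i : Fin n) :
    (powAdd X m n).hom ≫ projSnd (pow X m) (pow X n) ≫ powProj X n i =
      powProj X (m + n) (Fin.natAdd m i) := by
  induction n with
  | zero => exact i.elim0
  | succ n ih =>
    have hsnd := isComonHom_projSnd (pow X m) (pow X n)
    have hadd := isComonHom_powAdd X m n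
    induction i using Fin.lastCases with
    | last =>
      refine Eq.trans ?_ (powProj_last X (m + n)).symm
      rw [powProj_last]
      change ((powAdd X m n).hom ▷ X ≫ (α_ (pow X m) (pow X n) X).hom) ≫
        projSnd (pow X m) (pow X n ⊗ X) ≫ _ = _
      rw [Category.assoc, reassoc_of% (associator_projSnd (pow X m) (pow X n) X),
        whiskerRight_projSnd _ hsnd, whiskerRight_projSnd _ hadd]
    | cast i =>
      refine Eq.trans ?_ (powProj_castSucc X (m + n) (Fin.natAdd m i)).symm
      rw [powProj_castSucc, ← ih]
      change ((powAdd X m n).hom ▷ X ≫ (α_ (pow X m) (pow X n) X).hom) ≫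
        projSnd (pow X m) (pow X n ⊗ X) ≫ _ = _
      rw [Category.assoc, reassoc_of% (associator_projSnd (pow X m) (pow X n) X),
        reassoc_of% (whiskerRight_projFst (projSnd (pow X m) (pow X n)) X),
        reassoc_of% (whiskerRight_projFst (powAdd X m n).hom X)]

end PowComonoid

/-! ### The convolution monoid -/

section Convolution

open ComonObj MonObj

variable {C : Type u} [Category.{v} C] [MonoidalCategory C] [SymmetricCategory C]

/-- The convolution product on morphisms from a cocommutative comonoid to a commutative monoid. -/
@[reducible]
def convCommMonoid (A X : C) [ComonObj A] [IsCommComonObj A] [MonObj X] [IsCommMonObj X] :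
    CommMonoid (A ⟶ X) where
  toMonoid := inferInstanceAs (Monoid (Conv A X))
  mul_comm f g := by
    change Δ[A] ≫ f ▷ A ≫ X ◁ g ≫ μ[X] = Δ[A] ≫ g ▷ A ≫ X ◁ f ≫ μ[X]
    rw [← MonoidalCategory.tensorHom_def_assoc, ← MonoidalCategory.tensorHom_def_assoc,
      ← IsCommComonObj.comul_comm_assoc, ← BraidedCategory.braiding_naturality_assoc,
      IsCommMonObj.mul_comm]

attribute [local instance] convCommMonoid

variable {A B X : C} [ComonObj A] [IsCommComonObj A] [ComonObj B] [IsCommComonObj B] [MonObj X]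
  [IsCommMonObj X]

theorem conv_mul_def (f g : A ⟶ X) : f * g = Δ[A] ≫ (f ⊗ₘ g) ≫ μ[X] := by
  change Δ[A] ≫ f ▷ A ≫ X ◁ g ≫ μ[X] = _
  rw [← MonoidalCategory.tensorHom_def_assoc]

theorem conv_one_def : (1 : A ⟶ X) = ε[A] ≫ η[X] := rfl

variable (X) in
/-- Precomposition with a comonoid morphism, as a homomorphism of convolution monoids. -/
def convPrecomp (f : A ⟶ B) (hf : IsComonHom f) : (B ⟶ X) →* (A ⟶ X) where
  toFun g := f ≫ g
  map_one' := IsComonHom.hom_counit_assoc f _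
  map_mul' g h := by
    rw [conv_mul_def, conv_mul_def, hf.hom_comul_assoc, tensorHom_comp_tensorHom_assoc]

theorem comp_prod {J : Type*} (f : A ⟶ B) (hf : IsComonHom f) (g : J → (B ⟶ X)) (S : Finset J) :
    f ≫ ∏ i ∈ S, g i = ∏ i ∈ S, f ≫ g i :=
  map_prod (convPrecomp X f hf) g S

/-- A comonoid morphism slides through the comultiplication, leaving `f ≫ Δ ≫ μ`, which the special
law collapses to `f`. -/
theorem conv_mul_self [ComonObj X] (hs : Δ[X] ≫ μ[X] = 𝟙 X)
    (f : A ⟶ X) (hf : IsComonHom f) : f * f = f := by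
  rw [conv_mul_def, ← hf.hom_comul_assoc, hs, Category.comp_id]

theorem projFst_mul_projSnd [ComonObj X] [IsCommComonObj X] (f : A ⟶ X) :
    (projFst A X ≫ f) * projSnd A X = f ▷ X ≫ μ[X] := by
  rw [conv_mul_def, ← tensorHom_comp_whiskerRight_assoc, ← Category.assoc, comul_projFst_projSnd,
    Category.id_comp]

end Convolution

/-! ### Components of a term as products of projections -/

namespace SBB

open ComonObj MonObj

variable {C : Type u} [Category.{v} C] [MonoidalCategory C] [SymmetricCategory C]

attribute [local instance] ComonObj.instTensorUnit convCommMonoid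

/-- The operations on the tensor powers of an object carrying a monoid and a comonoid structure. -/
def opOf (X : C) [ComonObj X] [MonObj X] : ∀ {m n : ℕ}, Gen m n → (pow X m ⟶ pow X n)
  | _, _, .mul => ((λ_ X).hom ▷ X ≫ μ[X] ≫ (λ_ X).inv : (𝟙_ C ⊗ X) ⊗ X ⟶ 𝟙_ C ⊗ X)
  | _, _, .unit => (η[X] ≫ (λ_ X).inv : 𝟙_ C ⟶ 𝟙_ C ⊗ X)
  | _, _, .comul => ((λ_ X).hom ≫ Δ[X] ≫ (λ_ X).inv ▷ X : 𝟙_ C ⊗ X ⟶ (𝟙_ C ⊗ X) ⊗ X)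
  | _, _, .counit => ((λ_ X).hom ≫ ε[X] : 𝟙_ C ⊗ X ⟶ 𝟙_ C)

/-- The laws of a special bicommutative bimonoid which relate its commutative monoid and its
cocommutative comonoid structure. -/
class IsSpecialBimonoid (X : C) [ComonObj X] [MonObj X] : Prop where
  isComonHom_mul : IsComonHom μ[X]
  isComonHom_one : IsComonHom η[X]
  comul_mul : Δ[X] ≫ μ[X] = 𝟙 X

variable (X : C) [ComonObj X] [MonObj X] [IsCommComonObj X] [IsCommMonObj X] [IsSpecialBimonoid X]

-- The bimonoid and extra laws cover the multiplication and unit, cocommutativity covers the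
-- comultiplication, and the counit is a comonoid morphism for any comonoid.
omit [IsCommMonObj X] in
theorem isComonHom_opOf {m n : ℕ} (σ : Gen m n) : IsComonHom (opOf X σ) := by
  have := isComonHom_leftUnitor X
  have := IsSpecialBimonoid.isComonHom_mul (X := X)
  have := IsSpecialBimonoid.isComonHom_one (X := X)
  have := isComonHom_comul X
  have := isComonHom_counit X
  have h₁ := isComonHom_tensorHom (λ_ X).hom (𝟙 X)
  have h₂ := isComonHom_tensorHom (λ_ X).inv (𝟙 X)
  rw [tensorHom_id] at h₁ h₂
  cases σ with
  | mul =>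
    exact inferInstanceAs (IsComonHom
      ((λ_ X).hom ▷ X ≫ μ[X] ≫ (λ_ X).inv : (𝟙_ C ⊗ X) ⊗ X ⟶ 𝟙_ C ⊗ X))
  | unit => exact inferInstanceAs (IsComonHom (η[X] ≫ (λ_ X).inv : 𝟙_ C ⟶ 𝟙_ C ⊗ X))
  | comul =>
    exact inferInstanceAs (IsComonHom
      ((λ_ X).hom ≫ Δ[X] ≫ (λ_ X).inv ▷ X : 𝟙_ C ⊗ X ⟶ (𝟙_ C ⊗ X) ⊗ X))
  | counit => exact inferInstanceAs (IsComonHom ((λ_ X).hom ≫ ε[X] : 𝟙_ C ⊗ X ⟶ 𝟙_ C))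

omit [IsCommMonObj X] in
theorem isComonHom_eval {m n : ℕ} (t : Term Gen m n) : IsComonHom (t.eval X (opOf X)) := by
  induction t with
  | gen σ => exact isComonHom_opOf X σ
  | id n => exact inferInstanceAs (IsComonHom (𝟙 (pow X n)))
  | braid m n =>
    have := isComonHom_powAdd X m n
    have := isComonHom_powAdd X n m
    have := isComonHom_braiding (pow X m) (pow X n)
    exact inferInstanceAs (IsComonHom (_ ≫ _ ≫ (powAdd X n m).inv))
  | comp s t ihs iht => exact inferInstanceAs (IsComonHom (_ ≫ _))
  | @tensor m n p q s t ihs iht =>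
    have := isComonHom_powAdd X m p
    have := isComonHom_powAdd X n q
    have := isComonHom_tensorHom (s.eval X (opOf X)) (t.eval X (opOf X))
    exact inferInstanceAs (IsComonHom (_ ≫ _ ≫ (powAdd X n q).inv))

open Classical in
/-- The convolution product of a set of projections from a tensor power. -/
noncomputable def relProj {m : ℕ} (p : Fin m → Prop) : pow X m ⟶ X :=
  ∏ i with p i, powProj X m i

omit [IsSpecialBimonoid X] in
theorem relProj_eq {m : ℕ} (i : Fin m) : relProj X (fun k => k = i) = powProj X m i := by
  simp [relProj, Finset.filter_eq']

theorem powProj_mul_self {m : ℕ} (i : Fin m) :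
    powProj X m i * powProj X m i = powProj X m i :=
  conv_mul_self IsSpecialBimonoid.comul_mul _ (isComonHom_powProj X m i)

/-- Precomposition with a comonoid morphism distributes over convolution, giving a double product;
idempotence turns it into a product over a union, which is the existential quantifier of relational
composition. -/
theorem eval_comp_relProj {m n : ℕ} (R : Fin m → Fin n → Prop) (f : pow X m ⟶ pow X n)
    (hf : IsComonHom f) (h : ∀ j, f ≫ powProj X n j = relProj X fun i => R i j)
    (p : Fin n → Prop) : f ≫ relProj X p = relProj X fun i => ∃ j, R i j ∧ p j := by
  classical
  rw [relProj, comp_prod f hf]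
  simp only [h, relProj]
  rw [← prod_biUnion_of_idem _ (powProj_mul_self X)]
  refine Finset.prod_congr ?_ fun _ _ => rfl
  ext i
  simp [and_comm]

omit [IsSpecialBimonoid X] in
theorem relProj_castAdd {m n : ℕ} (p : Fin (m + n) → Prop) (h : ∀ j, ¬ p (Fin.natAdd m j)) :
    relProj X p = (powAdd X m n).hom ≫ projFst (pow X m) (pow X n) ≫
      relProj X fun i => p (Fin.castAdd n i) := by
  classical
  have h₁ := isComonHom_projFst (pow X m) (pow X n)
  have h₂ := isComonHom_powAdd X m n
  rw [relProj, relProj, comp_prod _ h₁, comp_prod _ h₂, Finset.prod_filter, Fin.prod_univ_add]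
  simp [h, Finset.prod_filter, powAdd_projFst_powProj]

omit [IsSpecialBimonoid X] in
theorem relProj_natAdd {m n : ℕ} (p : Fin (m + n) → Prop) (h : ∀ j, ¬ p (Fin.castAdd n j)) :
    relProj X p = (powAdd X m n).hom ≫ projSnd (pow X m) (pow X n) ≫
      relProj X fun i => p (Fin.natAdd m i) := by
  classical
  have h₁ := isComonHom_projSnd (pow X m) (pow X n)
  have h₂ := isComonHom_powAdd X m n
  rw [relProj, relProj, comp_prod _ h₁, comp_prod _ h₂, Finset.prod_filter, Fin.prod_univ_add]
  simp [h, Finset.prod_filter, powAdd_projSnd_powProj]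

omit [IsCommComonObj X] [IsCommMonObj X] [MonObj X] [IsSpecialBimonoid X] in
theorem comp_powAdd_inv_powProj_castAdd {m n : ℕ} {A B : C} (a : A ⟶ B)
    (f : B ⟶ pow X m ⊗ pow X n) (i : Fin m) :
    (a ≫ f ≫ (powAdd X m n).inv) ≫ powProj X (m + n) (Fin.castAdd n i) =
      a ≫ (f ≫ projFst (pow X m) (pow X n)) ≫ powProj X m i := by
  rw [Category.assoc, Category.assoc, (Iso.inv_comp_eq _).2 (powAdd_projFst_powProj X m n i).symm,
    Category.assoc]

omit [IsCommComonObj X] [IsCommMonObj X] [MonObj X] [IsSpecialBimonoid X] in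
theorem comp_powAdd_inv_powProj_natAdd {m n : ℕ} {A B : C} (a : A ⟶ B)
    (f : B ⟶ pow X m ⊗ pow X n) (i : Fin n) :
    (a ≫ f ≫ (powAdd X m n).inv) ≫ powProj X (m + n) (Fin.natAdd m i) =
      a ≫ (f ≫ projSnd (pow X m) (pow X n)) ≫ powProj X n i := by
  rw [Category.assoc, Category.assoc, (Iso.inv_comp_eq _).2 (powAdd_projSnd_powProj X m n i).symm,
    Category.assoc]

-- The multiplication is the convolution product of the two projections, the unit is the empty
-- product, and the components of the comultiplication are the single projection by the counit laws.
omit [IsSpecialBimonoid X] in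
theorem opOf_powProj {m n : ℕ} (σ : Gen m n) (j : Fin n) :
    opOf X σ ≫ powProj X n j = relProj X fun _ => True := by
  have h1 : powProj X 1 0 = (λ_ X).hom := by
    refine (powProj_last X 0).trans ?_
    change 𝟙 (𝟙_ C) ▷ X ≫ _ = _
    simp
  have h2 : powProj X 2 1 = projSnd (𝟙_ C ⊗ X) X := powProj_last X 1
  have h2' : powProj X 2 0 = projFst (𝟙_ C ⊗ X) X ≫ (λ_ X).hom :=
    (powProj_castSucc X 1 0).trans (congrArg (_ ≫ ·) h1)
  cases σ with
  | mul =>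
    rw [Subsingleton.elim j 0, h1]
    have h : (relProj X fun _ : Fin 2 => True) = powProj X 2 0 * powProj X 2 1 := by
      simp [relProj]
    rw [h, h2, h2']
    refine Eq.trans ?_ (projFst_mul_projSnd (λ_ X).hom).symm
    change ((λ_ X).hom ▷ X ≫ μ[X] ≫ (λ_ X).inv) ≫ (λ_ X).hom = _
    simp
  | unit =>
    rw [Subsingleton.elim j 0, h1]
    -- The empty convolution product is `ε ≫ η`, where `ε` is the identity on the unit object.
    have h : (relProj X fun _ : Fin 0 => True) = 𝟙 (𝟙_ C) ≫ η[X] :=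
      (Finset.prod_of_isEmpty _).trans (conv_one_def (A := pow X 0))
    rw [h]
    change (η[X] ≫ (λ_ X).inv) ≫ (λ_ X).hom = _
    simp
  | comul =>
    have : (relProj X fun _ : Fin 1 => True) = (λ_ X).hom := by
      refine Eq.trans ?_ h1
      simp [relProj]
    rw [this]
    have h₁ : ((λ_ X).hom ≫ Δ[X] ≫ (λ_ X).inv ▷ X) ≫ projFst (𝟙_ C ⊗ X) X ≫ (λ_ X).hom =
        (λ_ X).hom := by
      simp only [Category.assoc]
      rw [reassoc_of% (whiskerRight_projFst (λ_ X).inv X), projFst]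
      simp
    have h₂ : ((λ_ X).hom ≫ Δ[X] ≫ (λ_ X).inv ▷ X) ≫ projSnd (𝟙_ C ⊗ X) X = (λ_ X).hom := by
      have := isComonHom_leftUnitor X
      simp only [Category.assoc]
      rw [whiskerRight_projSnd (λ_ X).inv inferInstance, projSnd]
      simp
    fin_cases j
    · exact (congrArg (_ ≫ ·) h2').trans h₁
    · exact (congrArg (_ ≫ ·) h2).trans h₂
  | counit => exact j.elim0

/-- A normal form for components. Composition is `eval_comp_relProj`; in a tensor product a
component sees only one factor, because the other, being a comonoid morphism, is discarded. -/
theorem eval_powProj {m n : ℕ} (t : Term Gen m n) (j : Fin n) :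
    t.eval X (opOf X) ≫ powProj X n j = relProj X fun i => rel t i j := by
  induction t with
  | gen σ => exact opOf_powProj X σ j
  | id n => exact (Category.id_comp _).trans (relProj_eq X j).symm
  | braid m n =>
    have h : ∀ i, RelProp.data.braid m n i j ↔
        i = finSumFinEquiv (finSumFinEquiv.symm j).swap := by
      intro i
      change (finSumFinEquiv.symm i).swap = finSumFinEquiv.symm j ↔ _
      exact ⟨fun h => by rw [← h]; simp, fun h => by rw [h]; simp⟩
    have h' : (relProj X fun i => rel (.braid m n) i j) =
        powProj X (m + n) (finSumFinEquiv (finSumFinEquiv.symm j).swap) :=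
      (congrArg (relProj X) (funext fun i => propext (h i))).trans (relProj_eq X _)
    rw [h']
    clear h h'
    induction j using Fin.addCases with
    | left j =>
      refine (comp_powAdd_inv_powProj_castAdd X _ _ j).trans ?_
      rw [braiding_projFst, powAdd_projSnd_powProj]
      simp
    | right j =>
      refine (comp_powAdd_inv_powProj_natAdd X _ _ j).trans ?_
      rw [braiding_projSnd, powAdd_projFst_powProj]
      simp
  | comp s t ihs iht =>
    refine (Category.assoc _ _ _).trans ((congrArg (_ ≫ ·) (iht j)).trans ?_)
    exact eval_comp_relProj X _ _ (isComonHom_eval X s) ihs _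
  | @tensor m n p q s t ihs iht =>
    have hs := isComonHom_eval X s
    have ht := isComonHom_eval X t
    induction j using Fin.addCases with
    | left j =>
      refine (comp_powAdd_inv_powProj_castAdd X _ _ j).trans ?_
      rw [tensorHom_projFst, Category.assoc, ihs]
      refine Eq.trans ?_ (relProj_castAdd X _ fun i => (RelProp.tensor_rl _ _ _ _).1).symm
      simp only [← RelProp.tensor_ll (rel s) (rel t)]
      rfl
    | right j =>
      refine (comp_powAdd_inv_powProj_natAdd X _ _ j).trans ?_
      rw [tensorHom_projSnd, Category.assoc, iht]
      refine Eq.trans ?_ (relProj_natAdd X _ fun i => (RelProp.tensor_lr _ _ _ _).1).symm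
      simp only [← RelProp.tensor_rr (rel s) (rel t)]
      rfl

/-- Terms denoting the same relation have the same interpretation. -/
theorem eval_eq_of_rel_eq {m n : ℕ} {s t : Term Gen m n} (h : rel s = rel t) :
    s.eval X (opOf X) = t.eval X (opOf X) :=
  powProj_ext (isComonHom_eval X s) (isComonHom_eval X t) fun i => by
    rw [eval_powProj, eval_powProj, h]

end SBB

/-! ### The generating object as a bimonoid, and faithfulness -/

namespace SBB

open ComonObj MonObj

attribute [local instance] ComonObj.instTensorUnit convCommMonoid

/-- The generating object of the prop for special bicommutative bimonoids. -/
abbrev genObj : sbb.prop.Ob := ⟨1⟩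

/-- The morphism represented by a term. -/
def mk {m n : ℕ} (t : Term Gen m n) : (⟨m⟩ : sbb.prop.Ob) ⟶ ⟨n⟩ := sbb.ofTerm t

theorem mk_eq {m n : ℕ} {s t : Term Gen m n} (h : Eqn s t) : mk s = mk t :=
  Quot.sound (.of h)

/-- The multiplication on the generating object. -/
def genMul : genObj ⊗ genObj ⟶ genObj := mk mul

/-- The unit of the generating object. -/
def genUnit : 𝟙_ sbb.prop.Ob ⟶ genObj := mk unit

/-- The comultiplication on the generating object. -/
def genComul : genObj ⟶ genObj ⊗ genObj := mk comul

/-- The counit of the generating object. -/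
def genCounit : genObj ⟶ 𝟙_ sbb.prop.Ob := mk counit

theorem braiding_genMul : (β_ genObj genObj).hom ≫ genMul = genMul := mk_eq .comm

theorem genComul_braiding : genComul ≫ (β_ genObj genObj).hom = genComul := mk_eq .cocomm

theorem genUnit_genMul : genUnit ▷ genObj ≫ genMul = (λ_ genObj).hom := mk_eq .unit_left

theorem genComul_genCounit : genComul ≫ genCounit ▷ genObj = (λ_ genObj).inv :=
  mk_eq .counit_left

instance : MonObj genObj where
  one := genUnit
  mul := genMul
  one_mul := genUnit_genMul
  -- The theory contains only the left unit law; the right one follows from commutativity.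
  mul_one := by
    rw [← braiding_genMul, BraidedCategory.braiding_naturality_right_assoc, genUnit_genMul,
      braiding_leftUnitor]
  mul_assoc :=
    (mk_eq .assoc).trans (sbb.prop.id_comp (mk (.comp (.tensor (m := 1) one mul) mul))).symm

instance : ComonObj genObj where
  counit := genCounit
  comul := genComul
  counit_comul := genComul_genCounit
  comul_counit := by
    rw [← genComul_braiding, Category.assoc, ← BraidedCategory.braiding_naturality_left,
      reassoc_of% genComul_genCounit, leftUnitor_inv_braiding]
  comul_assoc :=
    (mk_eq .coassoc).symm.trans (congrArg (sbb.prop.comp (mk comul))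
      (sbb.prop.comp_id (mk (.tensor (n := 2) (q := 1) comul one))).symm)

instance : IsCommMonObj genObj where
  mul_comm := braiding_genMul

instance : IsCommComonObj genObj where
  comul_comm := genComul_braiding

/-- The exchange of the two middle strands on four copies of the generating object. -/
def genExch : (genObj ⊗ genObj) ⊗ genObj ⊗ genObj ⟶ (genObj ⊗ genObj) ⊗ genObj ⊗ genObj := mk exch

/-- All associators in `tensorμ` are identities in a prop, leaving only the middle braiding. -/
theorem tensorμ_genObj : tensorμ genObj genObj genObj genObj = genExch := by
  have key : ∀ (P : PROP.{0}) (f : P.Hom 3 3), P.comp (P.id 4) (P.comp (P.tensor (P.id 1) (P.id 3))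
      (P.comp (P.tensor (P.id 1) f) (P.comp (P.tensor (P.id 1) (P.id 3)) (P.id 4)))) =
      P.tensor (P.id 1) f := by
    intro P f
    rw [P.tensor_id, P.comp_id, P.comp_id, P.id_comp, P.id_comp]
  exact key sbb.prop (sbb.prop.tensor (sbb.prop.braid 1 1) (sbb.prop.id 1))

instance : IsSpecialBimonoid genObj where
  isComonHom_mul :=
    { hom_counit := by
        rw [Comon.tensorObj_counit]
        exact (mk_eq .mul_counit).trans (sbb.prop.comp_id _).symm
      hom_comul := by
        rw [Comon.tensorObj_comul, tensorμ_genObj, Category.assoc]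
        exact mk_eq .mul_comul }
  isComonHom_one :=
    { hom_counit := mk_eq .extra
      hom_comul := (mk_eq .unit_comul).trans (sbb.prop.id_comp _).symm }
  comul_mul := mk_eq .special

/-- The isomorphisms between the tensor powers of the generating object and the objects. -/
abbrev genPow (n : ℕ) : pow genObj n ≅ ⟨n⟩ := PROP.powIso (𝟭 sbb.prop.Ob) n

theorem opOf_genObj {m n : ℕ} (σ : Gen m n) :
    opOf genObj σ = (genPow m).hom ≫ mk (.gen σ) ≫ (genPow n).inv := by
  have h₁ : (genPow 1).hom = (λ_ genObj).hom :=
    (sbb.prop.comp_id (sbb.prop.tensor (sbb.prop.id 0) (sbb.prop.id 1))).trans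
      (sbb.prop.tensor_id 0 1)
  have h₁' : (genPow 1).inv = (λ_ genObj).inv := congrArg Iso.inv (Iso.ext h₁)
  have h₂ : (genPow 2).hom = (λ_ genObj).hom ▷ genObj :=
    (sbb.prop.comp_id (sbb.prop.tensor (m := 1) (n := 1) (genPow 1).hom (sbb.prop.id 1))).trans
      (congrArg (· ▷ genObj) h₁)
  have h₂' : (genPow 2).inv = (λ_ genObj).inv ▷ genObj :=
    congrArg Iso.inv (Iso.ext (β := whiskerRightIso (λ_ genObj) genObj) h₂)
  cases σ with
  | mul => rw [h₁', h₂]; rfl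
  | unit => rw [h₁']; exact (Category.id_comp _).symm
  | comul => rw [h₁, h₂']; rfl
  | counit => rw [h₁]; exact congrArg (_ ≫ ·) (Category.comp_id _).symm

/-- The generating object is the generic model: `Algebra.eval_eq` for the identity functor shows
that evaluating a term there returns its class up to the isomorphisms `genPow`, which cancel. -/
theorem mk_eq_of_rel_eq {m n : ℕ} {s t : Term Gen m n} (h : rel s = rel t) : mk s = mk t := by
  have := eval_eq_of_rel_eq genObj h
  have hop : (fun {m n : ℕ} (σ : Gen m n) => opOf genObj σ) =
    fun {m n} σ => (genPow m).hom ≫ (𝟭 sbb.prop.Ob).map (sbb.ofTerm (.gen σ)) ≫ (genPow n).inv := by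
    funext m n σ
    exact opOf_genObj σ
  have h₁ : ∀ t : Term Gen m n,
      t.eval genObj (opOf genObj) = (genPow m).hom ≫ mk t ≫ (genPow n).inv := by
    intro t
    refine Eq.trans ?_ (Algebra.eval_eq (𝟭 sbb.prop.Ob) t)
    exact congrArg (fun op : ∀ {m n : ℕ}, Gen m n → (pow genObj m ⟶ pow genObj n) =>
      t.eval genObj op) hop
  rw [h₁, h₁] at this
  simpa using this

theorem toRel_bijective (m n : ℕ) :
    Function.Bijective (fun f : sbb.prop.Hom m n => PROP.Morphism.map toRel f) := by
  refine ⟨?_, fun R => ?_⟩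
  · rintro ⟨s⟩ ⟨t⟩ h
    exact mk_eq_of_rel_eq h
  · obtain ⟨t, ht⟩ := definable m n R
    exact ⟨mk t, ht⟩

/-- The props of relations and of special bicommutative bimonoids are isomorphic. -/
theorem nonempty_relProp_iso_prop : Nonempty (relProp ≅ sbb.prop) :=
  (PROP.nonempty_iso toRel toRel_bijective).map Iso.symm

end SBB

/-! ### Equivalence with finite sets and relations -/

namespace RelProp

/-- The functor sending `n` to the finite set `Fin n`. -/
def toFinRel : relProp.Ob ⥤ FinRel where
  obj n := ⟨Fin n.val⟩
  map R := R
  map_id _ := rfl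
  map_comp _ _ := rfl

instance : toFinRel.Full where
  map_surjective R := ⟨R, rfl⟩

instance : toFinRel.Faithful where
  map_injective h := h

instance : toFinRel.EssSurj where
  mem_essImage X := by
    obtain ⟨n, ⟨e⟩⟩ := Finite.exists_equiv_fin X.carrier
    exact ⟨⟨n⟩, ⟨FinRel.graphIso (X := toFinRel.obj ⟨n⟩) (Y := X) e.symm⟩⟩

instance : toFinRel.IsEquivalence where

/-- The canonical isomorphism for the tensor units. -/
def unitIso : 𝟙_ FinRel ≅ toFinRel.obj (𝟙_ relProp.Ob) :=
  FinRel.graphIso (X := 𝟙_ FinRel) (Y := toFinRel.obj (𝟙_ relProp.Ob))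
    (Equiv.equivOfIsEmpty Empty (Fin 0))

/-- The canonical isomorphism for tensor products. -/
def tensorIso (m n : relProp.Ob) : toFinRel.obj m ⊗ toFinRel.obj n ≅ toFinRel.obj (m ⊗ n) :=
  FinRel.graphIso (X := toFinRel.obj m ⊗ toFinRel.obj n) (Y := toFinRel.obj (m ⊗ n))
    finSumFinEquiv

theorem map_eqIso {m n : relProp.Ob} (h : m.val = n.val) :
    toFinRel.map (relProp.eqIso h).hom =
      (FinRel.graphIso (X := toFinRel.obj m) (Y := toFinRel.obj n) (finCongr h)).hom := by
  obtain ⟨m⟩ := m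
  obtain ⟨n⟩ := n
  obtain rfl : m = n := h
  rfl

theorem liftRel_iff_tensor {m n p q : ℕ} (R : data.Hom m n) (S : data.Hom p q) (x : Fin m ⊕ Fin p)
    (j : Fin (n + q)) : Sum.LiftRel R S x (finSumFinEquiv.symm j) ↔
      data.tensor R S (finSumFinEquiv x) j := by
  rw [tensor_iff, Equiv.symm_apply_apply]

/-- Every morphism in the associativity and unit axioms is the graph of a bijection, so these are
checked on elements; naturality is the definition of the tensor product in `relProp`. -/
instance : toFinRel.Monoidal :=
  Functor.CoreMonoidal.toMonoidal
    { εIso := unitIso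
      μIso := tensorIso
      μIso_hom_natural_left := fun R Z => FinRel.natural_of _ _ _ _ fun x j =>
        liftRel_iff_tensor R (data.id Z.val) x j
      μIso_hom_natural_right := fun Z R => FinRel.natural_of _ _ _ _ fun x j =>
        liftRel_iff_tensor (data.id Z.val) R x j
      associativity := fun X Y Z => by
        refine (congrArg₂ (· ≫ ·) (FinRel.tensor_graphIso_id _ _)
          ((congrArg (_ ≫ ·) (map_eqIso _)).trans (FinRel.graphIso_comp_graphIso _ _))).trans ?_
        refine (FinRel.graphIso_comp_graphIso _ _).trans (Eq.symm ?_)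
        refine (congrArg (_ ≫ ·) ((congrArg (· ≫ _) (FinRel.tensor_id_graphIso _ _)).trans
          (FinRel.graphIso_comp_graphIso _ _))).trans ?_
        refine (FinRel.graphIso_comp_graphIso _ _).trans (FinRel.graphIso_congr ?_)
        rintro ((x | x) | x)
        · rfl
        · rfl
        · exact Fin.ext (Nat.add_assoc _ _ _).symm
      left_unitality := fun X => by
        refine Eq.trans ?_ (congrArg₂ (· ≫ ·) (FinRel.tensor_graphIso_id _ _)
          ((congrArg (_ ≫ ·) (map_eqIso _)).trans (FinRel.graphIso_comp_graphIso _ _))).symm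
        refine Eq.trans ?_ (FinRel.graphIso_comp_graphIso _ _).symm
        refine FinRel.graphIso_congr ?_
        rintro (x | x)
        · exact x.elim
        · exact Fin.ext (Nat.zero_add _).symm
      right_unitality := fun X => by
        refine Eq.trans ?_ (congrArg₂ (· ≫ ·) (FinRel.tensor_id_graphIso _ _)
          ((congrArg (_ ≫ ·) (map_eqIso _)).trans (FinRel.graphIso_comp_graphIso _ _))).symm
        refine Eq.trans ?_ (FinRel.graphIso_comp_graphIso _ _).symm
        refine FinRel.graphIso_congr ?_
        rintro (x | x)
        · rfl
        · exact x.elim }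

/-- The braiding of the prop of relations is the graph of a bijection. -/
theorem map_braiding (m n : relProp.Ob) :
    toFinRel.map (β_ m n).hom = (FinRel.graphIso (X := toFinRel.obj (m ⊗ n))
      (Y := toFinRel.obj (n ⊗ m))
      (finSumFinEquiv.symm.trans ((Equiv.sumComm _ _).trans finSumFinEquiv))).hom :=
  FinRel.hom_ext fun _ _ => (Equiv.eq_symm_apply _)

instance : toFinRel.Braided where
  braided m n := by
    change (tensorIso m n).hom ≫ _ = (FinRel.swapIso _ _).hom ≫ (tensorIso n m).hom
    refine (congrArg (_ ≫ ·) (map_braiding m n)).trans ?_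
    refine (FinRel.graphIso_comp_graphIso _ _).trans ?_
    refine Eq.trans ?_ (FinRel.graphIso_comp_graphIso _ _).symm
    exact FinRel.graphIso_congr fun x => congrArg (fun y => finSumFinEquiv (Sum.swap y))
      (finSumFinEquiv.symm_apply_apply x)

end RelProp
end SymMonTheory

/-- The prop `relProp` of relations is equivalent, as a symmetric monoidal category, to the category
of finite sets and relations with disjoint union; `sbb.prop` is the prop for special bicommutative
bimonoids; and these two props are isomorphic. -/
theorem mainTheorem2 :
    (∃ (F : SymMonTheory.relProp.Ob ⥤ SymMonTheory.FinRel) (_ : F.Braided), F.IsEquivalence) ∧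
      SymMonTheory.IsPropFor.{v, u, 0} SymMonTheory.sbb.prop SymMonTheory.sbb ∧
      Nonempty (SymMonTheory.relProp ≅ SymMonTheory.sbb.prop) :=
  ⟨⟨SymMonTheory.RelProp.toFinRel, inferInstance, inferInstance⟩,
    SymMonTheory.isPropFor_prop SymMonTheory.sbb, SymMonTheory.SBB.nonempty_relProp_iso_prop⟩
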